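/- \textbf{Setting.} Let $\gamma\ge 3$, $\kappa\ge 0$, $m\ge 0$ and $L\ge 2m+1$ be integers. Let $H_0,\dots,H_m$ be $0/1$ matrices of size $\gamma\times\kappa$ whose sum is the all-ones matrix. The binary protograph matrix $H_{SC}$ of the spatially coupled (SC) code with memory $m$ and coupling length $L$ is the $\gamma(L+m)\times\kappa L$ matrix consisting of $\gamma\times\kappa$ blocks whose block in block row $a$ and block column $\rho$ ($1\le a\le L+m$, $1\le\rho\le L$) is $H_{a-\rho}$ if $0\le a-\rho\le m$ and $0$ otherwise. The block column $\rho$ is called the $\rho$-th replica. For a finite set $I$ of integers in $\{0,\dots,(m+1)\gamma-1\}$ the overlap parameter $t_I$ is the number of columns in which the stacked matrix $[H_0^T\ H_1^T\cdots H_m^T]^T$ (with rows numbered from $0$) has a $1$ in all the rows indexed by $I$. An instance of Pattern $P_9$ is a cycle of length $8$ (as a subgraph: four distinct rows and four distinct columns traversed cyclically, chords being allowed) in the bipartite graph of $H_{SC}$, whose vertices are the rows (check nodes) and columns (variable nodes) of $H_{SC}$ and whose edges are its ones. Let $F_{P_9}$ be the total number of instances, and let $F^k_{P_9,1}$ be the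 number of those for which the smallest index of a replica containing one of the four columns is $1$ and the largest is $k$. \textbf{Theorem.} $$F_{P_9}=\sum_{k=1}^{2m+1}(L-k+1)\,F^k_{P_9,1},$$ and for $1\le k\le 2m+1$ the numbers $F^k_{P_9,1}$ are given as follows. \textbf{Notation.} Put $(x)^+=\max\{x,0\}$, and for integers $a,b$ put $[a,b)=\{a\gamma,a\gamma+1,\dots,b\gamma-1\}$ (empty if $a\ge b$). Abbreviate $t_{12}=t_{\{i_1,i_2\}}$, $t_{123}=t_{\{i_1,i_2,i_3\}}$, etc., and for an integer $d$ write $t_{12}[d]=t_{\{i_1+d\gamma,\,i_2+d\gamma\}}$, etc. All sums over $i_1,\dots,i_4$ are restricted by $$i_1\not\equiv i_2,\quad i_2\not\equiv i_3,\quad i_3\not\equiv i_4,\quad i_1\not\equiv i_4\ (\mathrm{mod}\ \gamma),\qquad i_1\ne i_3,\quad i_2\ne i_4;$$ a condition $\{i_x,i_y\}\subset S$ means that the two-element subset $\{i_x,i_y\}$ of $S$ is counted once (say with $i_x<i_y$). Define \begin{align*} \mathcal A={}&t_{1234}\big[(t_{1234}-1)^+(t_{134}-2)^+(t_{14}-3)^++(t_{1234}-1)^+(t_{34}-t_{134})(t_{14}-2)^+\\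 &\quad+(t_{234}-t_{1234})(t_{134}-1)^+(t_{14}-2)^++(t_{234}-t_{1234})(t_{34}-t_{134}-1)^+(t_{14}-1)^+\\ &\quad+(t_{23}-t_{234})(t_{134}-1)^+(t_{14}-2)^++(t_{23}-t_{234})(t_{34}-t_{134})(t_{14}-1)^+\big]\\ &+(t_{123}-t_{1234})\big[t_{1234}(t_{134}-1)^+(t_{14}-2)^++t_{1234}(t_{34}-t_{134})(t_{14}-1)^+\\ &\quad+(t_{234}-t_{1234})t_{134}(t_{14}-1)^++(t_{234}-t_{1234})(t_{34}-t_{134}-1)^+t_{14}\\ &\quad+(t_{23}-t_{234}-1)^+t_{134}(t_{14}-1)^++(t_{23}-t_{234}-1)^+(t_{34}-t_{134})t_{14}\big]\\ &+(t_{124}-t_{1234})\big[t_{1234}(t_{134}-1)^+(t_{14}-3)^++t_{1234}(t_{34}-t_{134})(t_{14}-2)^+\\ &\quad+(t_{234}-t_{1234})t_{134}(t_{14}-2)^++(t_{234}-t_{1234})(t_{34}-t_{134}-1)^+(t_{14}-1)^+\\ &\quad+(t_{23}-t_{234})t_{134}(t_{14}-2)^++(t_{23}-t_{234})(t_{34}-t_{134})(t_{14}-1)^+\big]\\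 &+(t_{12}-t_{123}-t_{124}+t_{1234})\big[t_{1234}(t_{134}-1)^+(t_{14}-2)^++t_{1234}(t_{34}-t_{134})(t_{14}-1)^+\\ &\quad+(t_{234}-t_{1234})t_{134}(t_{14}-1)^++(t_{234}-t_{1234})(t_{34}-t_{134}-1)^+t_{14}\\ &\quad+(t_{23}-t_{234})t_{134}(t_{14}-1)^++(t_{23}-t_{234})(t_{34}-t_{134})t_{14}\big], \end{align*} and, for integers $d,d',d''$, \begin{align*} \mathcal B[d]={}&\big[t_{1234}(t_{234}-1)^+(t_{34}-2)^++t_{1234}(t_{23}-t_{234})(t_{34}-1)^+\\ &+(t_{123}-t_{1234})t_{234}(t_{34}-1)^++(t_{123}-t_{1234})(t_{23}-t_{234}-1)^+t_{34}\\ &+(t_{12}-t_{123})t_{234}(t_{34}-1)^++(t_{12}-t_{123})(t_{23}-t_{234})t_{34}\big]\,t_{14}[d],\\ \mathcal C[d]={}&\big[t_{123}(t_{23}-1)^++(t_{12}-t_{123})t_{23}\big]\big[t_{134}[d](t_{14}[d]-1)^++(t_{34}[d]-t_{134}[d])t_{14}[d]\big],\\ \mathcal D[d]={}&\big[t_{1234}(t_{34}-1)^++(t_{12}-t_{1234})t_{34}\big]\big[t_{1234}[d](t_{14}[d]-1)^++(t_{23}[d]-t_{1234}[d])t_{14}[d]\big],\\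 \mathcal E[d,d']={}&\big[t_{123}(t_{23}-1)^++(t_{12}-t_{123})t_{23}\big]\,t_{34}[d]\,t_{14}[d'],\\ \mathcal G[d,d']={}&\big[t_{1234}(t_{34}-1)^++(t_{12}-t_{1234})t_{34}\big]\,t_{23}[d]\,t_{14}[d'],\\ \mathcal I[d,d',d'']={}&t_{12}\,t_{23}[d]\,t_{34}[d']\,t_{14}[d'']. \end{align*} \textbf{Formulas.} First, $$F^1_{P_9,1}=\frac12\sum_{\{i_1,i_3\}\subset[0,m+1),\ \{i_2,i_4\}\subset[0,m+1)}\mathcal A .$$ For $2\le k\le 2m+1$, $$F^k_{P_9,1}=T_k+\sum_{h=2}^{k-1}U_{k,h}+\sum_{h=2}^{k-2}\ \sum_{w=h+1}^{k-1}V_{k,h,w}$$ (so $F^2_{P_9,1}=T_2$ and $F^3_{P_9,1}=T_3+U_{3,2}$), where \begin{align*} T_k={}&\sum_{\{i_1,i_4\}\subset[k-1,m+1),\ i_2,i_3\in[0,m+1)}\mathcal B[1-k] +\sum_{\{i_1,i_4\}\subset[0,m-k+2),\ i_2,i_3\in[0,m+1)}\mathcal B[k-1]\\ &+\sum_{\{i_1,i_3\}\subset[k-1,m+1),\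 i_2\in[0,m+1),\ i_4\in[k-1,m+k)}\mathcal C[1-k] +\frac12\sum_{\{i_1,i_4\}\subset[k-1,m+1),\ i_2,i_3\in[k-1,m+1)}\mathcal D[1-k],\\ U_{k,h}={}&\sum_{i_1\in[k-1,m+1),\ i_2\in[0,m+1),\ i_3\in[h-1,m+1),\ i_4\in[k-1,m+h)}\mathcal E[1-h,1-k]\\ &+\sum_{i_1\in[k-h,m+1),\ i_2\in[0,m+1),\ i_3\in[0,m-h+2),\ i_4\in[k-h,m-h+2)}\mathcal E[h-1,h-k]\\ &+\sum_{i_1\in[0,m-k+h+1),\ i_2\in[0,m+1),\ i_3\in[0,m-k+2),\ i_4\in[h-k,m-k+2)}\mathcal E[k-1,k-h]\\ &+\sum_{\{i_1,i_4\}\subset[k-1,m+1),\ i_2,i_3\in[h-1,m+1)}\mathcal G[1-h,1-k] +\sum_{\{i_1,i_4\}\subset[k-h,m+1),\ i_2,i_3\in[0,m-h+2)}\mathcal G[h-1,h-k]\\ &+\sum_{\{i_1,i_4\}\subset[0,m-k+h+1),\ i_2,i_3\in[0,m-k+2)}\mathcal G[k-1,k-h],\\ V_{k,h,w}={}&\sum_{i_1\in[k-1,m+1),\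 i_2\in[h-1,m+1),\ i_3\in[w-1,m+h),\ i_4\in[k-1,m+w)}\mathcal I[1-h,1-w,1-k]\\ &+\sum_{i_1\in[k-1,m+1),\ i_2\in[w-1,m+1),\ i_3\in[w-1,m+h),\ i_4\in[k-1,m+h)}\mathcal I[1-w,1-h,1-k]\\ &+\sum_{i_1\in[w-1,m+1),\ i_2\in[h-1,m+1),\ i_3\in[k-1,m+h),\ i_4\in[k-1,m+w)}\mathcal I[1-h,1-k,1-w]. \end{align*} -/

import Mathlib

open Finset

namespace SCCode

/-- A partitioning of the all-ones `γ × κ` protograph matrix of the underlying block code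
(which has no zero circulants) into `m + 1` disjoint binary component matrices. -/
structure Partitioning (γ κ m : ℕ) where
  /-- the protograph matrix of the `y`-th component matrix, `0 ≤ y ≤ m` -/
  comp : Fin (m + 1) → Matrix (Fin γ) (Fin κ) ℕ
  zero_or_one : ∀ y i j, comp y i j = 0 ∨ comp y i j = 1
  sum_eq_one : ∀ i j, ∑ y, comp y i j = 1

variable {γ κ m : ℕ}

/-- The protograph matrix of the SC code with coupling length `L`, of size `γ(L+m) × κL`: in block
row `a` and block column (replica) `ρ`, both counted from `0`, it has the component matrix of
index `a - ρ` if `0 ≤ a - ρ ≤ m`, and zeros otherwise. -/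
def Partitioning.scMatrix (P : Partitioning γ κ m) (L : ℕ) :
    Matrix (Fin ((L + m) * γ)) (Fin (L * κ)) ℕ := fun c v =>
  if h : v.divNat.val ≤ c.divNat.val ∧ c.divNat.val - v.divNat.val < m + 1 then
    P.comp ⟨c.divNat.val - v.divNat.val, h.2⟩ c.modNat v.modNat
  else 0

/-- The replica of the SC code, counted from `0`, in which a variable node (column) lies. -/
def replica {L : ℕ} (v : Fin (L * κ)) : ℕ := v.divNat.val

/-- The `(m+1)γ × κ` matrix in which the component matrices are stacked on top of each other. -/
def Partitioning.stacked (P : Partitioning γ κ m) : Matrix (Fin ((m + 1) * γ)) (Fin κ) ℕ :=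
  fun i j => P.comp i.divNat i.modNat j

/-- The overlap parameter of a set `I` of row indices: the number of columns of the stacked matrix
in which all the rows indexed by `I` have a `1`. Row indices are integers because the index shifts
below are; all those that occur there are in the range `0, …, (m+1)γ - 1` of actual rows. -/
def Partitioning.overlap (P : Partitioning γ κ m) (I : Finset ℤ) : ℤ :=
  #{j : Fin κ | ∀ i ∈ I, ∃ a : Fin ((m + 1) * γ), (a.val : ℤ) = i ∧ P.stacked a j = 1}

/-! ### Instances of the pattern -/

/-- An instance of the pattern `P₉` in the graph of a binary matrix `H` is a cycle of length `8`,
given by its set `S` of edges: there are four distinct rows (check nodes) `c 0, …, c 3` and four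
distinct columns (variable nodes) `v 0, …, v 3` such that `v x` is adjacent to `c x` and to
`c (x + 1)` (indices modulo `4`), and `S` consists of these eight edges. -/
def IsP9 {R C : Type*} [DecidableEq R] [DecidableEq C] (H : Matrix R C ℕ) (S : Finset (R × C)) :
    Prop :=
  ∃ (c : Fin 4 → R) (v : Fin 4 → C), Function.Injective c ∧ Function.Injective v ∧
    (∀ x, H (c x) (v x) = 1 ∧ H (c (x + 1)) (v x) = 1) ∧
    S = univ.image (fun x => (c x, v x)) ∪ univ.image (fun x => (c (x + 1), v x))

/-- The total number of instances of `P₉` in the protograph of the SC code. -/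
noncomputable def Partitioning.numP9 (P : Partitioning γ κ m) (L : ℕ) : ℕ :=
  {S | IsP9 (P.scMatrix L) S}.ncard

/-- The number of instances of `P₉` that start at the first replica and span `k` consecutive
replicas: the first replica containing a variable node of the instance is the replica `0`, and the
last one is the replica `k - 1`. -/
noncomputable def Partitioning.numP9Span (P : Partitioning γ κ m) (L k : ℕ) : ℕ :=
  {S | IsP9 (P.scMatrix L) S ∧ (∃ e ∈ S, replica e.2 = 0) ∧ (∃ e ∈ S, replica e.2 + 1 = k) ∧
    ∀ e ∈ S, replica e.2 + 1 ≤ k}.ncard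

/-! ### The functions of the overlap parameters

Here `t12` stands for `t_{i₁,i₂}`, and so on; in `fB`, …, `fI` the letters `u`, `w`, `x` stand for
overlap parameters `t` with shifted indices. -/

/-- All four overlaps are in one replica. -/
def fA (t12 t23 t34 t14 t123 t124 t134 t234 t1234 : ℤ) : ℤ :=
  (t1234 * (t1234 - 1)⁺ * (t134 - 2)⁺ * (t14 - 3)⁺
    + t1234 * (t1234 - 1)⁺ * (t34 - t134) * (t14 - 2)⁺
    + t1234 * (t234 - t1234) * (t134 - 1)⁺ * (t14 - 2)⁺
    + t1234 * (t234 - t1234) * (t34 - t134 - 1)⁺ * (t14 - 1)⁺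
    + t1234 * (t23 - t234) * (t134 - 1)⁺ * (t14 - 2)⁺
    + t1234 * (t23 - t234) * (t34 - t134) * (t14 - 1)⁺)
  + ((t123 - t1234) * t1234 * (t134 - 1)⁺ * (t14 - 2)⁺
    + (t123 - t1234) * t1234 * (t34 - t134) * (t14 - 1)⁺
    + (t123 - t1234) * (t234 - t1234) * t134 * (t14 - 1)⁺
    + (t123 - t1234) * (t234 - t1234) * (t34 - t134 - 1)⁺ * t14
    + (t123 - t1234) * (t23 - t234 - 1)⁺ * t134 * (t14 - 1)⁺
    + (t123 - t1234) * (t23 - t234 - 1)⁺ * (t34 - t134) * t14)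
  + ((t124 - t1234) * t1234 * (t134 - 1)⁺ * (t14 - 3)⁺
    + (t124 - t1234) * t1234 * (t34 - t134) * (t14 - 2)⁺
    + (t124 - t1234) * (t234 - t1234) * t134 * (t14 - 2)⁺
    + (t124 - t1234) * (t234 - t1234) * (t34 - t134 - 1)⁺ * (t14 - 1)⁺
    + (t124 - t1234) * (t23 - t234) * t134 * (t14 - 2)⁺
    + (t124 - t1234) * (t23 - t234) * (t34 - t134) * (t14 - 1)⁺)
  + ((t12 - t123 - t124 + t1234) * t1234 * (t134 - 1)⁺ * (t14 - 2)⁺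
    + (t12 - t123 - t124 + t1234) * t1234 * (t34 - t134) * (t14 - 1)⁺
    + (t12 - t123 - t124 + t1234) * (t234 - t1234) * t134 * (t14 - 1)⁺
    + (t12 - t123 - t124 + t1234) * (t234 - t1234) * (t34 - t134 - 1)⁺ * t14
    + (t12 - t123 - t124 + t1234) * (t23 - t234) * t134 * (t14 - 1)⁺
    + (t12 - t123 - t124 + t1234) * (t23 - t234) * (t34 - t134) * t14)

/-- Three overlaps are in one replica and the `c₁-c₄` overlap is in another one. -/
def fB (t12 t23 t34 t123 t234 t1234 u14 : ℤ) : ℤ :=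
  (t1234 * (t234 - 1)⁺ * (t34 - 2)⁺
    + t1234 * (t23 - t234) * (t34 - 1)⁺
    + (t123 - t1234) * t234 * (t34 - 1)⁺
    + (t123 - t1234) * (t23 - t234 - 1)⁺ * t34
    + (t12 - t123) * t234 * (t34 - 1)⁺
    + (t12 - t123) * (t23 - t234) * t34) * u14

/-- The `c₁-c₂` and `c₂-c₃` overlaps are in one replica, the `c₃-c₄` and `c₁-c₄` overlaps in
another one. -/
def fC (t12 t23 t123 u34 u14 u134 : ℤ) : ℤ :=
  (t123 * (t23 - 1)⁺ + (t12 - t123) * t23) * (u134 * (u14 - 1)⁺ + (u34 - u134) * u14)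

/-- The `c₁-c₂` and `c₃-c₄` overlaps are in one replica, the `c₂-c₃` and `c₁-c₄` overlaps in
another one. -/
def fD (t12 t34 t1234 u23 u14 u1234 : ℤ) : ℤ :=
  (t1234 * (t34 - 1)⁺ + (t12 - t1234) * t34) * (u1234 * (u14 - 1)⁺ + (u23 - u1234) * u14)

/-- The `c₁-c₂` and `c₂-c₃` overlaps are in one replica, the `c₃-c₄` and `c₁-c₄` overlaps in two
other ones. -/
def fE (t12 t23 t123 u34 w14 : ℤ) : ℤ :=
  (t123 * (t23 - 1)⁺ + (t12 - t123) * t23) * u34 * w14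

/-- The `c₁-c₂` and `c₃-c₄` overlaps are in one replica, the `c₂-c₃` and `c₁-c₄` overlaps in two
other ones. -/
def fG (t12 t34 t1234 u23 w14 : ℤ) : ℤ :=
  (t1234 * (t34 - 1)⁺ + (t12 - t1234) * t34) * u23 * w14

/-- The four overlaps are in four replicas. -/
def fI (t12 u23 w34 x14 : ℤ) : ℤ := t12 * u23 * w34 * x14

/-! ### The summations -/

/-- The condition on the indices that all the summations share. -/
abbrev Adm (γ : ℕ) (i₁ i₂ i₃ i₄ : ℤ) : Prop :=
  i₁ % γ ≠ i₂ % γ ∧ i₁ ≠ i₃ ∧ i₁ % γ ≠ i₄ % γ ∧ i₂ % γ ≠ i₃ % γ ∧ i₂ ≠ i₄ ∧ i₃ % γ ≠ i₄ % γ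

/-- `rng γ a b` is the set `{aγ, …, bγ - 1}` of integers. -/
noncomputable abbrev rng (γ : ℕ) (a b : ℤ) : Finset ℤ := Ico (a * γ) (b * γ)

/-- Summation over admissible indices with `i₁ ∈ S₁`, …, `i₄ ∈ S₄`. -/
def sumAll (γ : ℕ) (S₁ S₂ S₃ S₄ : Finset ℤ) (f : ℤ → ℤ → ℤ → ℤ → ℤ) : ℤ :=
  ∑ i₁ ∈ S₁, ∑ i₂ ∈ S₂, ∑ i₃ ∈ S₃, ∑ i₄ ∈ S₄, if Adm γ i₁ i₂ i₃ i₄ then f i₁ i₂ i₃ i₄ else 0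

/-- Summation over admissible indices with `{i₁, i₃} ⊂ S` and `{i₂, i₄} ⊂ T`; each two-element set
occurs once, and its elements are named in increasing order. -/
def sumPair13Pair24 (γ : ℕ) (S T : Finset ℤ) (f : ℤ → ℤ → ℤ → ℤ → ℤ) : ℤ :=
  ∑ i₁ ∈ S, ∑ i₃ ∈ S with i₁ < i₃, ∑ i₂ ∈ T, ∑ i₄ ∈ T with i₂ < i₄,
    if Adm γ i₁ i₂ i₃ i₄ then f i₁ i₂ i₃ i₄ else 0

/-- Summation over admissible indices with `{i₁, i₄} ⊂ S` (as above), `i₂ ∈ S₂` and `i₃ ∈ S₃`. -/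
def sumPair14 (γ : ℕ) (S S₂ S₃ : Finset ℤ) (f : ℤ → ℤ → ℤ → ℤ → ℤ) : ℤ :=
  ∑ i₁ ∈ S, ∑ i₄ ∈ S with i₁ < i₄, ∑ i₂ ∈ S₂, ∑ i₃ ∈ S₃,
    if Adm γ i₁ i₂ i₃ i₄ then f i₁ i₂ i₃ i₄ else 0

/-- Summation over admissible indices with `{i₁, i₃} ⊂ S` (as above), `i₂ ∈ S₂` and `i₄ ∈ S₄`. -/
def sumPair13 (γ : ℕ) (S S₂ S₄ : Finset ℤ) (f : ℤ → ℤ → ℤ → ℤ → ℤ) : ℤ :=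
  ∑ i₁ ∈ S, ∑ i₃ ∈ S with i₁ < i₃, ∑ i₂ ∈ S₂, ∑ i₄ ∈ S₄,
    if Adm γ i₁ i₂ i₃ i₄ then f i₁ i₂ i₃ i₄ else 0

section Formula

variable (γ : ℕ) (m : ℤ) (t : Finset ℤ → ℤ)

/-- Overlaps in the first replica only. -/
noncomputable def formulaOne : ℚ :=
  1 / 2 * (sumPair13Pair24 γ (rng γ 0 (m + 1)) (rng γ 0 (m + 1)) fun i₁ i₂ i₃ i₄ =>
    fA (t {i₁, i₂}) (t {i₂, i₃}) (t {i₃, i₄}) (t {i₁, i₄}) (t {i₁, i₂, i₃}) (t {i₁, i₂, i₄})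
      (t {i₁, i₃, i₄}) (t {i₂, i₃, i₄}) (t {i₁, i₂, i₃, i₄}) : ℤ)

/-- Overlaps in the two replicas `1` and `k`. -/
noncomputable def formulaTwo (k : ℤ) : ℚ :=
  (sumPair14 γ (rng γ (k - 1) (m + 1)) (rng γ 0 (m + 1)) (rng γ 0 (m + 1)) fun i₁ i₂ i₃ i₄ =>
    fB (t {i₁, i₂}) (t {i₂, i₃}) (t {i₃, i₄}) (t {i₁, i₂, i₃}) (t {i₂, i₃, i₄})
      (t {i₁, i₂, i₃, i₄}) (t {i₁ + (1 - k) * γ, i₄ + (1 - k) * γ}) : ℤ)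
  + (sumPair14 γ (rng γ 0 (m - k + 2)) (rng γ 0 (m + 1)) (rng γ 0 (m + 1)) fun i₁ i₂ i₃ i₄ =>
    fB (t {i₁, i₂}) (t {i₂, i₃}) (t {i₃, i₄}) (t {i₁, i₂, i₃}) (t {i₂, i₃, i₄})
      (t {i₁, i₂, i₃, i₄}) (t {i₁ + (k - 1) * γ, i₄ + (k - 1) * γ}) : ℤ)
  + (sumPair13 γ (rng γ (k - 1) (m + 1)) (rng γ 0 (m + 1)) (rng γ (k - 1) (m + k))
      fun i₁ i₂ i₃ i₄ =>
    fC (t {i₁, i₂}) (t {i₂, i₃}) (t {i₁, i₂, i₃})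
      (t {i₃ + (1 - k) * γ, i₄ + (1 - k) * γ}) (t {i₁ + (1 - k) * γ, i₄ + (1 - k) * γ})
      (t {i₁ + (1 - k) * γ, i₃ + (1 - k) * γ, i₄ + (1 - k) * γ}) : ℤ)
  + 1 / 2 * (sumPair14 γ (rng γ (k - 1) (m + 1)) (rng γ (k - 1) (m + 1)) (rng γ (k - 1) (m + 1))
      fun i₁ i₂ i₃ i₄ =>
    fD (t {i₁, i₂}) (t {i₃, i₄}) (t {i₁, i₂, i₃, i₄})
      (t {i₂ + (1 - k) * γ, i₃ + (1 - k) * γ}) (t {i₁ + (1 - k) * γ, i₄ + (1 - k) * γ})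
      (t {i₁ + (1 - k) * γ, i₂ + (1 - k) * γ, i₃ + (1 - k) * γ, i₄ + (1 - k) * γ}) : ℤ)

/-- Overlaps in the three replicas `1 < h < k`. -/
noncomputable def formulaThree (k h : ℤ) : ℚ :=
  (sumAll γ (rng γ (k - 1) (m + 1)) (rng γ 0 (m + 1)) (rng γ (h - 1) (m + 1))
      (rng γ (k - 1) (m + h)) fun i₁ i₂ i₃ i₄ =>
    fE (t {i₁, i₂}) (t {i₂, i₃}) (t {i₁, i₂, i₃})
      (t {i₃ + (1 - h) * γ, i₄ + (1 - h) * γ}) (t {i₁ + (1 - k) * γ, i₄ + (1 - k) * γ}) : ℤ)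
  + (sumAll γ (rng γ (k - h) (m + 1)) (rng γ 0 (m + 1)) (rng γ 0 (m - h + 2))
      (rng γ (k - h) (m - h + 2)) fun i₁ i₂ i₃ i₄ =>
    fE (t {i₁, i₂}) (t {i₂, i₃}) (t {i₁, i₂, i₃})
      (t {i₃ + (h - 1) * γ, i₄ + (h - 1) * γ}) (t {i₁ + (h - k) * γ, i₄ + (h - k) * γ}) : ℤ)
  + (sumAll γ (rng γ 0 (m - k + h + 1)) (rng γ 0 (m + 1)) (rng γ 0 (m - k + 2))
      (rng γ (h - k) (m - k + 2)) fun i₁ i₂ i₃ i₄ =>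
    fE (t {i₁, i₂}) (t {i₂, i₃}) (t {i₁, i₂, i₃})
      (t {i₃ + (k - 1) * γ, i₄ + (k - 1) * γ}) (t {i₁ + (k - h) * γ, i₄ + (k - h) * γ}) : ℤ)
  + (sumPair14 γ (rng γ (k - 1) (m + 1)) (rng γ (h - 1) (m + 1)) (rng γ (h - 1) (m + 1))
      fun i₁ i₂ i₃ i₄ =>
    fG (t {i₁, i₂}) (t {i₃, i₄}) (t {i₁, i₂, i₃, i₄})
      (t {i₂ + (1 - h) * γ, i₃ + (1 - h) * γ}) (t {i₁ + (1 - k) * γ, i₄ + (1 - k) * γ}) : ℤ)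
  + (sumPair14 γ (rng γ (k - h) (m + 1)) (rng γ 0 (m - h + 2)) (rng γ 0 (m - h + 2))
      fun i₁ i₂ i₃ i₄ =>
    fG (t {i₁, i₂}) (t {i₃, i₄}) (t {i₁, i₂, i₃, i₄})
      (t {i₂ + (h - 1) * γ, i₃ + (h - 1) * γ}) (t {i₁ + (h - k) * γ, i₄ + (h - k) * γ}) : ℤ)
  + (sumPair14 γ (rng γ 0 (m - k + h + 1)) (rng γ 0 (m - k + 2)) (rng γ 0 (m - k + 2))
      fun i₁ i₂ i₃ i₄ =>
    fG (t {i₁, i₂}) (t {i₃, i₄}) (t {i₁, i₂, i₃, i₄})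
      (t {i₂ + (k - 1) * γ, i₃ + (k - 1) * γ}) (t {i₁ + (k - h) * γ, i₄ + (k - h) * γ}) : ℤ)

/-- Overlaps in the four replicas `1 < h < w < k`. -/
noncomputable def formulaFour (k h w : ℤ) : ℚ :=
  (sumAll γ (rng γ (k - 1) (m + 1)) (rng γ (h - 1) (m + 1)) (rng γ (w - 1) (m + h))
      (rng γ (k - 1) (m + w)) fun i₁ i₂ i₃ i₄ =>
    fI (t {i₁, i₂}) (t {i₂ + (1 - h) * γ, i₃ + (1 - h) * γ})
      (t {i₃ + (1 - w) * γ, i₄ + (1 - w) * γ}) (t {i₁ + (1 - k) * γ, i₄ + (1 - k) * γ}) : ℤ)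
  + (sumAll γ (rng γ (k - 1) (m + 1)) (rng γ (w - 1) (m + 1)) (rng γ (w - 1) (m + h))
      (rng γ (k - 1) (m + h)) fun i₁ i₂ i₃ i₄ =>
    fI (t {i₁, i₂}) (t {i₂ + (1 - w) * γ, i₃ + (1 - w) * γ})
      (t {i₃ + (1 - h) * γ, i₄ + (1 - h) * γ}) (t {i₁ + (1 - k) * γ, i₄ + (1 - k) * γ}) : ℤ)
  + (sumAll γ (rng γ (w - 1) (m + 1)) (rng γ (h - 1) (m + 1)) (rng γ (k - 1) (m + h))
      (rng γ (k - 1) (m + w)) fun i₁ i₂ i₃ i₄ =>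
    fI (t {i₁, i₂}) (t {i₂ + (1 - h) * γ, i₃ + (1 - h) * γ})
      (t {i₃ + (1 - k) * γ, i₄ + (1 - k) * γ}) (t {i₁ + (1 - w) * γ, i₄ + (1 - w) * γ}) : ℤ)

/-- The closed formula, as a function of the overlap parameters `t`, for the number of instances
that start at the first replica and span `k` replicas, `k ≥ 1`. For `k = 2` the summations over
`h` and `w` are empty; for `k = 3` only the value `h = 2` of the first one remains. -/
noncomputable def formula (k : ℤ) : ℚ :=
  if k = 1 then formulaOne γ m t
  else formulaTwo γ m t k + ∑ h ∈ Icc 2 (k - 1), formulaThree γ m t k h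
    + ∑ h ∈ Icc 2 (k - 2), ∑ w ∈ Icc (h + 1) (k - 1), formulaFour γ m t k h w

end Formula

end SCCode

/-! Give every 8-cycle a starting row and a direction. An instance then becomes exactly eight
ordered cycles (`ncard_orderedCycle`), and each ordered cycle has a quadruple `r` of replicas
containing its columns. Counted in the doubly infinite code, the number `numCycles P r` is invariant
under translation, rotation and reversal. It vanishes if two replicas differ by more than `2 * m`,
because neighbouring columns share a row. Every cycle with replicas in `[0, L)` already lies in the
finite code. A quadruple of span `k` has `L - k + 1` possible starting positions, and this gives the
first identity.

For the closed formulas, `spanSum_eq` sorts the quadruples with minimum `0` and maximum `k - 1` into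
dihedral orbits of size 2, 4 or 8, keeping one representative each; for `k = 1` there is a single
quadruple. For a representative and fixed admissible rows, the columns are four distinct elements of
four sets, the sets of common columns of consecutive rows (`cyclesAt_eq`). Inclusion-exclusion
(`injQuadruples_eq_card`) expresses their number by cardinalities of intersections. These are
overlap parameters, or zero when two different replicas meet, so each replica pattern has its own
polynomial.

The functions `fA`, ..., `fG` count the same choices column by column, with positive parts. They
agree with the polynomials because a positive part can differ from its argument only where its
cofactor vanishes (`mul_posPart_eq`). Finally, the reflections that preserve the replica pattern
turn sums over ordered rows into sums over unordered pairs. Orbit size times this symmetry factor,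
divided by 8, is the coefficient 1 or 1/2 in the formulas. -/

namespace SCCode

/-! ### Instances as classes of eight ordered cycles. -/

section OrderedCycles

variable {R C : Type*}

/-- The edges of the closed walk that visits the rows `c x` and the columns `v x` alternately. -/
def edgeSet [DecidableEq R] [DecidableEq C] (c : Fin 4 → R) (v : Fin 4 → C) : Finset (R × C) :=
  univ.image (fun x => (c x, v x)) ∪ univ.image (fun x => (c (x + 1), v x))

/-- An `8`-cycle with a starting point and a direction, in the bipartite graph with adjacency
relation `A`. -/
def IsOrderedCycle (A : R → C → Prop) (c : Fin 4 → R) (v : Fin 4 → C) : Prop :=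
  Function.Injective c ∧ Function.Injective v ∧ ∀ x, A (c x) (v x) ∧ A (c (x + 1)) (v x)

variable [DecidableEq R] [DecidableEq C]

lemma mem_edgeSet {c : Fin 4 → R} {v : Fin 4 → C} {e : R × C} :
    e ∈ edgeSet c v ↔ (∃ x, (c x, v x) = e) ∨ ∃ x, (c (x + 1), v x) = e := by
  simp [edgeSet]

lemma forall_mem_edgeSet {c : Fin 4 → R} {v : Fin 4 → C} {p : C → Prop} :
    (∀ e ∈ edgeSet c v, p e.2) ↔ ∀ x, p (v x) := by
  simp only [mem_edgeSet]
  constructor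
  · exact fun h x => h (c x, v x) (Or.inl ⟨x, rfl⟩)
  · rintro h e (⟨x, rfl⟩ | ⟨x, rfl⟩) <;> exact h x

lemma exists_mem_edgeSet {c : Fin 4 → R} {v : Fin 4 → C} {p : C → Prop} :
    (∃ e ∈ edgeSet c v, p e.2) ↔ ∃ x, p (v x) := by
  have := (forall_mem_edgeSet (c := c) (v := v) (p := fun y => ¬ p y)).not
  push Not at this
  exact this

lemma edgeSet_comp (c : Fin 4 → R) (v : Fin 4 → C) (σ τ : Fin 4 → Fin 4) :
    edgeSet (c ∘ σ) (v ∘ τ) = (edgeSet σ τ).image (Prod.map c v) := by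
  simp only [edgeSet, image_union, image_image]
  rfl

/-- The symmetries of the `8`-cycle. -/
def cycleSymmetries : Finset (Equiv.Perm (Fin 4) × Equiv.Perm (Fin 4)) :=
  univ.filter fun σ => edgeSet σ.1 σ.2 = edgeSet id id

-- These are the symmetries of the octagon that preserve the colouring into rows and columns: a
-- dihedral group of order 8, found here by enumerating all pairs of permutations.
set_option maxRecDepth 100000 in
lemma card_cycleSymmetries : #cycleSymmetries = 8 := by
  decide +kernel

/-- An ordered cycle with the same edges visits the same rows and columns, so it is a unique
relabelling of `(c, v)`, and the relabelling has to preserve the edges of the model octagon. -/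
lemma card_sameEdges [Fintype R] [Fintype C] {c : Fin 4 → R} {v : Fin 4 → C}
    (hc : Function.Injective c) (hv : Function.Injective v) :
    #{p : (Fin 4 → R) × (Fin 4 → C) | (Function.Injective p.1 ∧ Function.Injective p.2) ∧
      edgeSet p.1 p.2 = edgeSet c v} = 8 := by
  have himg : Function.Injective (Finset.image (Prod.map c v)) :=
    Finset.image_injective (hc.prodMap hv)
  have hid : edgeSet c v = (edgeSet id id).image (Prod.map c v) := edgeSet_comp c v id id
  rw [← card_cycleSymmetries]
  symm
  refine Finset.card_bij (fun σ _ => (c ∘ σ.1, v ∘ σ.2)) ?_ ?_ ?_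
  · intro σ hσ
    simp only [cycleSymmetries, mem_filter, mem_univ, true_and] at hσ ⊢
    refine ⟨⟨hc.comp σ.1.injective, hv.comp σ.2.injective⟩, ?_⟩
    rw [edgeSet_comp, hσ, hid]
  · intro σ _ τ _ h
    simp only [Prod.mk.injEq] at h
    refine Prod.ext (Equiv.ext fun x => hc (congrFun h.1 x)) (Equiv.ext fun x => hv (congrFun h.2 x))
  · rintro ⟨c', v'⟩ h
    simp only [mem_filter, mem_univ, true_and] at h
    obtain ⟨⟨hc', hv'⟩, h⟩ := h
    -- Each new row and column is an end of an edge of the old cycle; this yields the relabelling.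
    have key : ∀ x, ∃ y z, c y = c' x ∧ v z = v' x := by
      intro x
      have hx : (c' x, v' x) ∈ edgeSet c v := by
        rw [← h, mem_edgeSet]
        exact Or.inl ⟨x, rfl⟩
      rcases mem_edgeSet.1 hx with ⟨y, hy⟩ | ⟨y, hy⟩ <;> rw [Prod.mk.injEq] at hy
      · exact ⟨y, y, hy.1, hy.2⟩
      · exact ⟨y + 1, y, hy.1, hy.2⟩
    choose σ τ hσ hτ using key
    have hσi : Function.Injective σ := fun x y hxy => hc' (by rw [← hσ, ← hσ, hxy])
    have hτi : Function.Injective τ := fun x y hxy => hv' (by rw [← hτ, ← hτ, hxy])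
    have hc'' : c' = c ∘ σ := funext fun x => (hσ x).symm
    have hv'' : v' = v ∘ τ := funext fun x => (hτ x).symm
    refine ⟨(Equiv.ofBijective σ (Finite.injective_iff_bijective.1 hσi),
      Equiv.ofBijective τ (Finite.injective_iff_bijective.1 hτi)), ?_, ?_⟩
    · simp only [cycleSymmetries, mem_filter, mem_univ, true_and]
      apply himg
      rw [← hid, ← h, hc'', hv'', edgeSet_comp]
      rfl
    · rw [hc'', hv'']
      rfl

/-- Every instance of the pattern comes from eight ordered cycles. -/
lemma ncard_orderedCycle [Fintype R] [Fintype C] (H : Matrix R C ℕ) (Q : Finset (R × C) → Prop) :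
    {p : (Fin 4 → R) × (Fin 4 → C) | IsOrderedCycle (fun i j => H i j = 1) p.1 p.2 ∧
      Q (edgeSet p.1 p.2)}.ncard = 8 * {S | IsP9 H S ∧ Q S}.ncard := by
  classical
  have h1 : {p : (Fin 4 → R) × (Fin 4 → C) | IsOrderedCycle (fun i j => H i j = 1) p.1 p.2 ∧
      Q (edgeSet p.1 p.2)} = ↑(univ.filter fun p : (Fin 4 → R) × (Fin 4 → C) =>
        IsOrderedCycle (fun i j => H i j = 1) p.1 p.2 ∧ Q (edgeSet p.1 p.2)) := by
    ext; simp
  have h2 : {S | IsP9 H S ∧ Q S} = ↑(univ.filter fun S => IsP9 H S ∧ Q S) := by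
    ext; simp
  rw [h1, h2, Set.ncard_coe_finset, Set.ncard_coe_finset,
    Finset.card_eq_sum_card_fiberwise (f := fun p => edgeSet p.1 p.2)
      (t := univ.filter fun S => IsP9 H S ∧ Q S)]
  · rw [mul_comm, ← smul_eq_mul, ← Finset.sum_const]
    refine Finset.sum_congr rfl fun S hS => ?_
    simp only [mem_filter, mem_univ, true_and] at hS
    obtain ⟨⟨c, v, hc, hv, hA, rfl⟩, hQ⟩ := hS
    rw [← card_sameEdges hc hv]
    congr 1
    ext ⟨c', v'⟩
    simp only [mem_filter, mem_univ, true_and]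
    constructor
    · rintro ⟨⟨⟨h1, h2, -⟩, -⟩, h⟩
      exact ⟨⟨h1, h2⟩, h⟩
    -- Adjacency and `Q` depend only on the edge set, so injectivity and equality of edge sets
    -- suffice.
    · rintro ⟨⟨h1, h2⟩, h⟩
      have hall : ∀ e ∈ edgeSet c v, H e.1 e.2 = 1 := by
        intro e he
        rcases mem_edgeSet.1 he with ⟨x, rfl⟩ | ⟨x, rfl⟩
        exacts [(hA x).1, (hA x).2]
      refine ⟨⟨⟨h1, h2, fun x => ⟨?_, ?_⟩⟩, ?_⟩, h⟩
      · exact hall (c' x, v' x) (h ▸ mem_edgeSet.2 (Or.inl ⟨x, rfl⟩))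
      · exact hall (c' (x + 1), v' x) (h ▸ mem_edgeSet.2 (Or.inr ⟨x, rfl⟩))
      · rw [h]; exact hQ
  · intro p hp
    simp only [coe_filter, mem_univ, true_and, Set.mem_ofPred_eq] at hp ⊢
    exact ⟨⟨p.1, p.2, hp.1.1, hp.1.2.1, hp.1.2.2, rfl⟩, hp.2⟩

end OrderedCycles

variable {γ κ m : ℕ}

/-! ### The doubly infinite code, its symmetries, and the reduction of the finite code to it. -/

section UnboundedCode

/-- Adjacency of the row `i` and the column `j` of replica `r` in the doubly infinite SC code. -/
def Adj (P : Partitioning γ κ m) (i r : ℤ) (j : Fin κ) : Prop :=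
  ∃ a : Fin ((m + 1) * γ), (a.val : ℤ) = i - r * γ ∧ P.stacked a j = 1

lemma Adj.bounds {P : Partitioning γ κ m} {i r : ℤ} {j : Fin κ} (h : Adj P i r j) :
    r * γ ≤ i ∧ i < (r + m + 1) * γ := by
  obtain ⟨a, ha, -⟩ := h
  have := a.isLt
  zify at this
  constructor
  · lia
  · linarith

lemma adj_add (P : Partitioning γ κ m) (i r s : ℤ) (j : Fin κ) :
    Adj P (i + s * γ) (r + s) j ↔ Adj P i r j := by
  unfold Adj
  rw [show i + s * γ - (r + s) * γ = i - r * γ by ring]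

/-- Subtracting `r * γ` from a row lowers its block index by `r` and keeps its residue. The single
condition that the difference indexes a stacked row encodes both inequalities in `scMatrix`. -/
lemma scMatrix_eq_one_iff (P : Partitioning γ κ m) {L : ℕ} (c : Fin ((L + m) * γ))
    (v : Fin (L * κ)) : P.scMatrix L c v = 1 ↔ Adj P c.val (replica v) v.modNat := by
  have hγ : 0 < γ := Nat.pos_of_mul_pos_left (c.pos)
  unfold Partitioning.scMatrix Adj replica Partitioning.stacked
  have hdiv : c.divNat.val = c.val / γ := rfl
  constructor
  · intro h
    split_ifs at h with h'
    · have e1 : v.divNat.val * γ ≤ c.val := (Nat.le_div_iff_mul_le hγ).1 h'.1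
      have e2 : (c.val - v.divNat.val * γ) / γ = c.divNat.val - v.divNat.val := by
        rw [Nat.mul_comm v.divNat.val γ, Nat.sub_mul_div]; rfl
      have e3 : (c.val - v.divNat.val * γ) % γ = c.val % γ := by
        rw [Nat.mul_comm v.divNat.val γ]
        exact Nat.sub_mul_mod (by rwa [mul_comm] at e1)
      refine ⟨⟨c.val - v.divNat.val * γ, ?_⟩, ?_, ?_⟩
      · rw [← Nat.div_lt_iff_lt_mul hγ, e2]
        exact h'.2
      · push_cast [e1]
        rfl
      · refine Eq.trans ?_ h
        congr 1
        · exact Fin.ext e2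
        · exact Fin.ext e3
  · rintro ⟨a, ha, h⟩
    have ha' : c.val = a.val + γ * v.divNat.val := by
      zify; linarith
    have e2 : c.val / γ = a.val / γ + v.divNat.val := by
      rw [ha', Nat.add_mul_div_left _ _ hγ]
    have e3 : c.val % γ = a.val % γ := by
      rw [ha', Nat.add_mul_mod_self_left]
    have e4 : a.val / γ < m + 1 := a.divNat.isLt
    have h' : v.divNat.val ≤ c.divNat.val ∧ c.divNat.val - v.divNat.val < m + 1 := by
      rw [hdiv, e2]
      exact ⟨Nat.le_add_left _ _, by rwa [Nat.add_sub_cancel]⟩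
    rw [dif_pos h']
    refine Eq.trans ?_ h
    congr 1
    · congr 1
      change c.val / γ - v.divNat.val = a.val / γ
      rw [e2, Nat.add_sub_cancel]
    · exact Fin.ext e3

/-- Ordered `8`-cycles of the doubly infinite SC code, with columns `j x` in replicas `r x`. -/
def IsCodeCycle (P : Partitioning γ κ m) (r i : Fin 4 → ℤ) (j : Fin 4 → Fin κ) : Prop :=
  IsOrderedCycle (fun (i : ℤ) (v : ℤ × Fin κ) => Adj P i v.1 v.2) i (fun x => (r x, j x))

/-- The number of ordered `8`-cycles of the doubly infinite SC code whose columns lie in the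
replicas `r 0, …, r 3`. -/
noncomputable def numCycles (P : Partitioning γ κ m) (r : Fin 4 → ℤ) : ℕ :=
  {p : (Fin 4 → ℤ) × (Fin 4 → Fin κ) | IsCodeCycle P r p.1 p.2}.ncard

/-- The condition `hst` says that the two rows around column `x` are sent to the two rows around
column `τ x`, possibly exchanged. -/
lemma IsOrderedCycle.comp_perm {R C : Type*} {A : R → C → Prop} {c : Fin 4 → R} {v : Fin 4 → C}
    (h : IsOrderedCycle A c v) {σ τ : Equiv.Perm (Fin 4)}
    (hst : ∀ x, σ x = τ x ∧ σ (x + 1) = τ x + 1 ∨ σ x = τ x + 1 ∧ σ (x + 1) = τ x) :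
    IsOrderedCycle A (c ∘ σ) (v ∘ τ) := by
  refine ⟨h.1.comp σ.injective, h.2.1.comp τ.injective, fun x => ?_⟩
  have := h.2.2 (τ x)
  rcases hst x with ⟨h1, h2⟩ | ⟨h1, h2⟩ <;> simp only [Function.comp, h1, h2]
  exacts [this, this.symm]

lemma ncard_congr_equiv {α β : Type*} {s : Set α} {t : Set β} (e : α ≃ β)
    (h : ∀ a, a ∈ s ↔ e a ∈ t) : s.ncard = t.ncard := by
  rw [← Nat.card_coe_set_eq, ← Nat.card_coe_set_eq]
  exact Nat.card_congr (e.subtypeEquiv h)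

/-- The rotation of the rows and columns of an ordered cycle. -/
def rot : Equiv.Perm (Fin 4) := Equiv.addRight 1

/-- The reversal of the rows of an ordered cycle. -/
def reflRow : Equiv.Perm (Fin 4) := Equiv.neg _

/-- The reversal of the columns of an ordered cycle. -/
def reflCol : Equiv.Perm (Fin 4) := Equiv.subLeft 3

lemma isCodeCycle_rot (P : Partitioning γ κ m) (r i : Fin 4 → ℤ) (j : Fin 4 → Fin κ) :
    IsCodeCycle P r i j ↔ IsCodeCycle P (r ∘ rot) (i ∘ rot) (j ∘ rot) := by
  constructor
  · exact fun h => IsOrderedCycle.comp_perm h (by decide)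
  · intro h
    have := IsOrderedCycle.comp_perm h (σ := rot⁻¹) (τ := rot⁻¹) (by decide)
    simpa [Function.comp_def, IsCodeCycle] using this

/-- Column `3 - x` lies between rows `3 - x` and `4 - x = -x` modulo 4. Hence reversal acts on rows
by negation but on columns by `x ↦ 3 - x`. -/
lemma isCodeCycle_refl (P : Partitioning γ κ m) (r i : Fin 4 → ℤ) (j : Fin 4 → Fin κ) :
    IsCodeCycle P r i j ↔ IsCodeCycle P (r ∘ reflCol) (i ∘ reflRow) (j ∘ reflCol) := by
  constructor
  · exact fun h => IsOrderedCycle.comp_perm h (by decide)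
  · intro h
    have := IsOrderedCycle.comp_perm h (σ := reflRow⁻¹) (τ := reflCol⁻¹) (by decide)
    simpa [Function.comp_def, IsCodeCycle] using this

lemma isCodeCycle_add (P : Partitioning γ κ m) (r i : Fin 4 → ℤ) (j : Fin 4 → Fin κ) (s : ℤ) :
    IsCodeCycle P r i j ↔ IsCodeCycle P (fun x => r x + s) (fun x => i x + s * γ) j := by
  unfold IsCodeCycle IsOrderedCycle
  simp only [adj_add]
  simp [Function.Injective]

lemma numCycles_rot (P : Partitioning γ κ m) (r : Fin 4 → ℤ) :
    numCycles P (r ∘ rot) = numCycles P r :=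
  -- `arrowCongr` precomposes with the inverse, so `rot.symm` produces composition with `rot`.
  (ncard_congr_equiv ((rot.symm.arrowCongr (Equiv.refl ℤ)).prodCongr
    (rot.symm.arrowCongr (Equiv.refl _))) fun p => isCodeCycle_rot P r p.1 p.2).symm

lemma numCycles_refl (P : Partitioning γ κ m) (r : Fin 4 → ℤ) :
    numCycles P (r ∘ reflCol) = numCycles P r :=
  (ncard_congr_equiv ((reflRow.symm.arrowCongr (Equiv.refl ℤ)).prodCongr
    (reflCol.symm.arrowCongr (Equiv.refl _))) fun p => isCodeCycle_refl P r p.1 p.2).symm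

lemma numCycles_add (P : Partitioning γ κ m) (r : Fin 4 → ℤ) (s : ℤ) :
    numCycles P (fun x => r x + s) = numCycles P r :=
  (ncard_congr_equiv ((Equiv.addRight (fun _ => s * (γ : ℤ))).prodCongr (Equiv.refl _))
    fun p => isCodeCycle_add P r p.1 p.2 s).symm

/-- Two columns with a common row have replicas at distance at most `m`, and any two columns of the
cycle are at most two such steps apart. -/
lemma IsCodeCycle.replica_le {P : Partitioning γ κ m} {r i : Fin 4 → ℤ} {j : Fin 4 → Fin κ}
    (h : IsCodeCycle P r i j) (x y : Fin 4) : r y ≤ r x + 2 * m := by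
  have key : ∀ a b : Fin 4, (a = b + 1 ∨ b = a + 1) → r a ≤ r b + m := by
    have aux : ∀ k a b, Adj P (i k) (r a) (j a) → Adj P (i k) (r b) (j b) → r a ≤ r b + m := by
      intro k a b h1 h2
      have h3 := h1.bounds.1.trans_lt h2.bounds.2
      have := lt_of_mul_lt_mul_right h3 (by positivity)
      omega
    rintro a b (rfl | rfl)
    · exact aux (b + 1) _ _ (h.2.2 (b + 1)).1 (h.2.2 b).2
    · exact aux (a + 1) _ _ (h.2.2 a).2 (h.2.2 (a + 1)).1
  have h01 := key 0 1 (by decide)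
  have h10 := key 1 0 (by decide)
  have h12 := key 1 2 (by decide)
  have h21 := key 2 1 (by decide)
  have h23 := key 2 3 (by decide)
  have h32 := key 3 2 (by decide)
  have h30 := key 3 0 (by decide)
  have h03 := key 0 3 (by decide)
  fin_cases x <;> fin_cases y <;> simp <;> omega

lemma numCycles_eq_zero (P : Partitioning γ κ m) {r : Fin 4 → ℤ} {x y : Fin 4}
    (h : r x + 2 * m < r y) : numCycles P r = 0 := by
  have : {p : (Fin 4 → ℤ) × (Fin 4 → Fin κ) | IsCodeCycle P r p.1 p.2} = ∅ :=
    Set.eq_empty_iff_forall_notMem.2 fun p hp => by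
      have := IsCodeCycle.replica_le hp x y
      omega
  rw [numCycles, this, Set.ncard_empty]

/-- The ordered cycles of the finite SC code whose replicas satisfy a condition. -/
lemma ncard_scCycles (P : Partitioning γ κ m) (L : ℕ) (Q : (Fin 4 → ℤ) → Prop) [DecidablePred Q] :
    {p : (Fin 4 → Fin ((L + m) * γ)) × (Fin 4 → Fin (L * κ)) |
      IsOrderedCycle (fun i j => P.scMatrix L i j = 1) p.1 p.2 ∧
        Q (fun x => replica (p.2 x))}.ncard =
    ∑ r ∈ (Fintype.piFinset fun _ : Fin 4 => Ico (0 : ℤ) L) with Q r, numCycles P r := by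
  classical
  have h1 : {p : (Fin 4 → Fin ((L + m) * γ)) × (Fin 4 → Fin (L * κ)) |
      IsOrderedCycle (fun i j => P.scMatrix L i j = 1) p.1 p.2 ∧
        Q (fun x => replica (p.2 x))} =
      ↑(univ.filter fun p : (Fin 4 → Fin ((L + m) * γ)) × (Fin 4 → Fin (L * κ)) =>
        IsOrderedCycle (fun i j => P.scMatrix L i j = 1) p.1 p.2 ∧
        Q (fun x => replica (p.2 x))) := by
    ext; simp
  have hrep : ∀ v : Fin (L * κ), replica v < L := fun v => v.divNat.isLt
  have hext : ∀ v w : Fin (L * κ), replica v = replica w → v.modNat = w.modNat → v = w := by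
    intro v w h1 h2
    exact finProdFinEquiv.symm.injective (Prod.ext (Fin.ext h1) h2)
  rw [h1, Set.ncard_coe_finset,
    Finset.card_eq_sum_card_fiberwise (f := fun p x => (replica (p.2 x) : ℤ))
      (t := (Fintype.piFinset fun _ : Fin 4 => Ico (0 : ℤ) L).filter Q)]
  · refine Finset.sum_congr rfl fun r hr => ?_
    simp only [mem_filter, Fintype.mem_piFinset, mem_Ico] at hr
    obtain ⟨hr, hQ⟩ := hr
    rw [numCycles, ← Set.ncard_coe_finset]
    refine Set.ncard_congr (fun p _ => (fun x => ((p.1 x).val : ℤ), fun x => (p.2 x).modNat))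
      ?_ ?_ ?_
    · rintro ⟨c, v⟩ h
      simp only [coe_filter, mem_filter, mem_univ, true_and, Set.mem_ofPred_eq] at h ⊢
      obtain ⟨⟨⟨hc, hv, hA⟩, -⟩, rfl⟩ := h
      refine ⟨fun x y hxy => hc (Fin.ext (by simpa using hxy)), fun x y hxy => hv ?_, fun x => ?_⟩
      · simp only [Prod.mk.injEq, Nat.cast_inj] at hxy
        exact hext _ _ hxy.1 hxy.2
      · simpa only [scMatrix_eq_one_iff] using hA x
    · rintro ⟨c, v⟩ ⟨c', v'⟩ h h'
      simp only [coe_filter, mem_filter, mem_univ, true_and, Set.mem_ofPred_eq] at h h'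
      intro heq
      simp only [Prod.mk.injEq, funext_iff, Nat.cast_inj] at heq
      have e := h.2.trans h'.2.symm
      simp only [funext_iff, Nat.cast_inj] at e
      exact Prod.ext (funext fun x => Fin.ext (heq.1 x)) (funext fun x => hext _ _ (e x) (heq.2 x))
    · rintro ⟨i, j⟩ h
      -- Columns in replicas `0, ..., L - 1` have ones only in the rows of the finite matrix, so
      -- truncation loses no cycle.
      have hi : ∀ x, 0 ≤ i x ∧ i x < ((L + m) * γ : ℕ) := by
        intro x
        have hb := (h.2.2 x).1.bounds
        have h0 := hr x
        constructor
        · exact le_trans (mul_nonneg h0.1 (by positivity)) hb.1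
        · refine hb.2.trans_le ?_
          push_cast
          exact mul_le_mul_of_nonneg_right (by omega) (by positivity)
      have hi' : ∀ x, ∃ c : Fin ((L + m) * γ), (c.val : ℤ) = i x := fun x =>
        ⟨⟨(i x).toNat, by have := hi x; omega⟩, by have := hi x; simp; omega⟩
      have hv' : ∀ x, ∃ v : Fin (L * κ), (replica v : ℤ) = r x ∧ v.modNat = j x := by
        intro x
        have h0 := hr x
        have hl : (r x).toNat < L := by omega
        refine ⟨finProdFinEquiv (⟨(r x).toNat, hl⟩, j x), ?_⟩
        have hs := finProdFinEquiv.symm_apply_apply ((⟨(r x).toNat, hl⟩, j x) : Fin L × Fin κ)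
        have e1 := congrArg (fun p => p.1.val) hs
        have e2 := congrArg (fun p => p.2) hs
        refine ⟨?_, e2⟩
        change replica _ = _ at e1
        rw [e1]
        simp; omega
      choose c hc using hi'
      choose v hv using hv'
      obtain ⟨hinj, hinj', hA⟩ := h
      refine ⟨(c, v), ?_, ?_⟩
      · have hreq : (fun x => (replica (v x) : ℤ)) = r := funext fun x => (hv x).1
        simp only [coe_filter, mem_filter, mem_univ, true_and, Set.mem_ofPred_eq]
        refine ⟨⟨⟨fun x y hxy => hinj ?_, fun x y hxy => hinj' ?_, fun x => ?_⟩, ?_⟩, hreq⟩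
        · simp only [← hc, hxy]
        · simp only [← (hv _).1, ← (hv _).2, hxy]
        · simp only [scMatrix_eq_one_iff, hc, (hv _).1, (hv _).2]
          exact hA x
        · rw [hreq]
          exact hQ
      · exact Prod.ext (funext hc) (funext fun x => (hv x).2)
  · intro p hp
    simp only [coe_filter, mem_univ, true_and, Set.mem_ofPred_eq, Fintype.mem_piFinset,
      mem_Ico] at hp ⊢
    refine ⟨fun x => ⟨by positivity, by exact_mod_cast hrep _⟩, hp.2⟩

end UnboundedCode

/-! ### Sorting quadruples of replicas by minimum and span. -/

section SpanSums

/-- The sum of `N` over the quadruples with minimum `0` and maximum `k - 1`. -/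
noncomputable def spanSum (N : (Fin 4 → ℤ) → ℤ) (k : ℕ) : ℤ :=
  ∑ r ∈ (Fintype.piFinset fun _ : Fin 4 => Ico (0 : ℤ) k) with
    (∃ x, r x = 0) ∧ (∃ x, r x + 1 = (k : ℤ)), N r

/-- Fibre the box first by the span `k`, then by the minimum `s`. The minimum takes the `L - k + 1`
values of `[0, L - k]`, and translation by `-s` identifies each fibre with the index set of `spanSum
N k`. -/
lemma sum_eq_sum_spanSum {N : (Fin 4 → ℤ) → ℤ} (hN : ∀ r s, N (fun x => r x + s) = N r) (L : ℕ) :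
    ∑ r ∈ Fintype.piFinset fun _ : Fin 4 => Ico (0 : ℤ) L, N r =
      ∑ k ∈ Icc 1 L, ((L : ℤ) - k + 1) * spanSum N k := by
  obtain ⟨mn, hmn⟩ : ∃ mn : (Fin 4 → ℤ) → ℤ, ∀ r, (∀ x, mn r ≤ r x) ∧ ∃ x, r x = mn r :=
    ⟨fun r => univ.inf' univ_nonempty r, fun r => ⟨fun x => inf'_le _ (mem_univ x), by
      obtain ⟨x, -, hx⟩ := exists_mem_eq_inf' univ_nonempty r
      exact ⟨x, hx.symm⟩⟩⟩
  obtain ⟨mx, hmx⟩ : ∃ mx : (Fin 4 → ℤ) → ℤ, ∀ r, (∀ x, r x ≤ mx r) ∧ ∃ x, r x = mx r :=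
    ⟨fun r => univ.sup' univ_nonempty r, fun r => ⟨fun x => le_sup' _ (mem_univ x), by
      obtain ⟨x, -, hx⟩ := exists_mem_eq_sup' univ_nonempty r
      exact ⟨x, hx.symm⟩⟩⟩
  have hle : ∀ r, mn r ≤ mx r := fun r => ((hmn r).1 0).trans ((hmx r).1 0)
  have hmn0 : ∀ {r}, r ∈ (Fintype.piFinset fun _ : Fin 4 => Ico (0 : ℤ) L) → 0 ≤ mn r := by
    intro r hr
    obtain ⟨x, hx⟩ := (hmn r).2
    have := mem_Ico.1 (Fintype.mem_piFinset.1 hr x)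
    omega
  have hmxL : ∀ {r}, r ∈ (Fintype.piFinset fun _ : Fin 4 => Ico (0 : ℤ) L) → mx r < L := by
    intro r hr
    obtain ⟨x, hx⟩ := (hmx r).2
    have := mem_Ico.1 (Fintype.mem_piFinset.1 hr x)
    omega
  rw [← Finset.sum_fiberwise_of_maps_to (t := Icc 1 L) (g := fun r => (mx r - mn r + 1).toNat)]
  · refine Finset.sum_congr rfl fun k hk => ?_
    rw [mem_Icc] at hk
    rw [← Finset.sum_fiberwise_of_maps_to (t := Ico (0 : ℤ) (L - k + 1)) (g := mn)]
    · have : ∀ s ∈ Ico (0 : ℤ) (L - k + 1),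
          ∑ r ∈ ((Fintype.piFinset fun _ : Fin 4 => Ico (0 : ℤ) L).filter
            fun r => (mx r - mn r + 1).toNat = k) with mn r = s, N r = spanSum N k := by
        intro s hs
        rw [mem_Ico] at hs
        refine Finset.sum_nbij' (fun (r : Fin 4 → ℤ) x => r x + -s) (fun r x => r x + s) ?_ ?_ ?_ ?_ ?_
        · intro r hr
          simp only [mem_filter] at hr
          obtain ⟨⟨hr, h1⟩, h2⟩ := hr
          have hl := hle r
          obtain ⟨y, hy⟩ := (hmn r).2
          obtain ⟨z, hz⟩ := (hmx r).2
          simp only [mem_filter, Fintype.mem_piFinset, mem_Ico]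
          refine ⟨fun x => ?_, ⟨y, by omega⟩, ⟨z, by omega⟩⟩
          have h3 := (hmn r).1 x
          have h4 := (hmx r).1 x
          omega
        · intro r hr
          simp only [mem_filter, Fintype.mem_piFinset, mem_Ico] at hr ⊢
          obtain ⟨h0, ⟨y, hy⟩, ⟨z, hz⟩⟩ := hr
          have h1 : mn (fun x => r x + s) = s := by
            obtain ⟨u, hu⟩ := (hmn (fun x => r x + s)).2
            have h3 := (hmn (fun x => r x + s)).1 y
            have h4 := h0 u
            omega
          have h2 : mx (fun x => r x + s) = s + k - 1 := by
            obtain ⟨u, hu⟩ := (hmx (fun x => r x + s)).2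
            have h3 := (hmx (fun x => r x + s)).1 z
            have h4 := h0 u
            omega
          refine ⟨⟨fun x => ?_, by omega⟩, h1⟩
          have := h0 x
          omega
        · intro r _; simp
        · intro r _; simp
        · intro r _; exact (hN r (-s)).symm
      rw [Finset.sum_congr rfl this, sum_const, Int.card_Ico, nsmul_eq_mul]
      congr 1
      omega
    · intro r hr
      simp only [mem_filter] at hr
      have h1 := hmn0 hr.1
      have h2 := hmxL hr.1
      have h3 := hle r
      rw [mem_Ico]
      omega
  · intro r hr
    have h1 := hmn0 hr
    have h2 := hmxL hr
    have h3 := hle r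
    rw [mem_Icc]
    omega

lemma eight_mul_numP9 (P : Partitioning γ κ m) (L : ℕ) : (8 * P.numP9 L : ℤ) =
    ∑ r ∈ Fintype.piFinset fun _ : Fin 4 => Ico (0 : ℤ) L, (numCycles P r : ℤ) := by
  have h1 := ncard_orderedCycle (P.scMatrix L) fun _ => True
  have h2 := ncard_scCycles P L fun _ => True
  simp only [and_true, filter_true] at h1 h2
  have h3 := h1.symm.trans h2
  rw [Partitioning.numP9]
  exact_mod_cast h3

/-- The bound on the last replica shrinks the box `[0, L)` to `[0, k)`, so the count no longer
depends on `L`. -/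
lemma eight_mul_numP9Span (P : Partitioning γ κ m) {L k : ℕ} (hk : k ≤ L) :
    (8 * P.numP9Span L k : ℤ) = spanSum (fun r => numCycles P r) k := by
  have h1 := ncard_orderedCycle (P.scMatrix L) fun S => (∃ e ∈ S, replica e.2 = 0) ∧
    (∃ e ∈ S, replica e.2 + 1 = k) ∧ ∀ e ∈ S, replica e.2 + 1 ≤ k
  have h2 := ncard_scCycles P L fun r => (∃ x, r x = 0) ∧ (∃ x, r x + 1 = k) ∧ ∀ x, r x + 1 ≤ k
  have h3 : ∀ v : Fin 4 → Fin (L * κ), ((∃ x, (replica (v x) : ℤ) = 0) ∧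
      (∃ x, (replica (v x) : ℤ) + 1 = k) ∧ ∀ x, (replica (v x) : ℤ) + 1 ≤ k) ↔
      ((∃ x, replica (v x) = 0) ∧ (∃ x, replica (v x) + 1 = k) ∧ ∀ x, replica (v x) + 1 ≤ k) := by
    intro v
    norm_cast
  have h4 : ∀ (c : Fin 4 → Fin ((L + m) * γ)) (v : Fin 4 → Fin (L * κ)),
      ((∃ e ∈ edgeSet c v, replica e.2 = 0) ∧ (∃ e ∈ edgeSet c v, replica e.2 + 1 = k) ∧
        ∀ e ∈ edgeSet c v, replica e.2 + 1 ≤ k) ↔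
      ((∃ x, replica (v x) = 0) ∧ (∃ x, replica (v x) + 1 = k) ∧ ∀ x, replica (v x) + 1 ≤ k) := by
    intro c v
    rw [exists_mem_edgeSet (p := fun w => replica w = 0),
      exists_mem_edgeSet (p := fun w => replica w + 1 = k),
      forall_mem_edgeSet (p := fun w => replica w + 1 ≤ k)]
  simp only [h3] at h2
  simp only [h4] at h1
  have h5 := h1.symm.trans h2
  rw [Partitioning.numP9Span, spanSum]
  have h6 := congrArg (Nat.cast : ℕ → ℤ) h5
  rw [Nat.cast_mul, Nat.cast_sum, Nat.cast_ofNat] at h6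
  rw [h6]
  refine Finset.sum_congr ?_ fun _ _ => rfl
  ext r
  simp only [mem_filter, Fintype.mem_piFinset, mem_Ico]
  constructor
  · rintro ⟨h0, ha, hb, hc⟩
    exact ⟨fun x => ⟨(h0 x).1, by have := hc x; omega⟩, ha, hb⟩
  · rintro ⟨h0, ha, hb⟩
    exact ⟨fun x => ⟨(h0 x).1, by have := h0 x; omega⟩, ha, hb, fun x => by have := h0 x; omega⟩

lemma spanSum_numCycles_eq_zero (P : Partitioning γ κ m) {k : ℕ} (hk : 2 * m + 1 < k) :
    spanSum (fun r => numCycles P r) k = 0 := by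
  unfold spanSum
  refine Finset.sum_eq_zero fun r hr => ?_
  simp only [mem_filter] at hr
  obtain ⟨-, ⟨x, hx⟩, ⟨y, hy⟩⟩ := hr
  rw [numCycles_eq_zero P (x := x) (y := y) (by omega), Nat.cast_zero]

/-- Every instance is a translate of one that starts at the first replica. -/
lemma numP9_eq_sum (P : Partitioning γ κ m) {L : ℕ} (hL : 2 * m + 1 ≤ L) :
    (P.numP9 L : ℤ) =
      ∑ k ∈ Finset.Icc 1 (2 * m + 1), ((L : ℤ) - k + 1) * (P.numP9Span L k : ℤ) := by
  have h8 : (8 : ℤ) ≠ 0 := by norm_num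
  apply mul_left_cancel₀ h8
  rw [eight_mul_numP9, sum_eq_sum_spanSum (N := fun r => (numCycles P r : ℤ))
    (fun r s => by rw [numCycles_add]), mul_sum]
  symm
  refine Finset.sum_subset_zero_on_sdiff (Icc_subset_Icc_right hL) ?_ ?_
  · intro k hk
    simp only [mem_sdiff, mem_Icc] at hk
    rw [spanSum_numCycles_eq_zero P (by omega), mul_zero]
  · intro k hk
    rw [mem_Icc] at hk
    rw [← eight_mul_numP9Span P (by omega : k ≤ L)]
    ring

end SpanSums

/-! ### Dihedral orbits of quadruples of replicas. -/

section Classification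

lemma sum_piFinset_four {α : Type*} [DecidableEq α] (B : Fin 4 → Finset α)
    (N : (Fin 4 → α) → ℤ) : ∑ r ∈ Fintype.piFinset B, N r =
      ∑ a ∈ B 0, ∑ b ∈ B 1, ∑ c ∈ B 2, ∑ d ∈ B 3, N ![a, b, c, d] := by
  simp only [← Finset.sum_product']
  symm
  refine Finset.sum_nbij' (fun p : α × α × α × α => ![p.1, p.2.1, p.2.2.1, p.2.2.2])
    (fun r => (r 0, r 1, r 2, r 3)) ?_ ?_ ?_ ?_ ?_
  · intro p hp
    simp only [mem_product] at hp
    simp [Fintype.mem_piFinset, Fin.forall_fin_succ, hp]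
  · intro r hr
    simp only [Fintype.mem_piFinset] at hr
    simp [hr]
  · intro p _; simp
  · intro r _
    ext x
    fin_cases x <;> rfl
  · intro p _; rfl

/-- Inclusion-exclusion: avoiding the value `0`, avoiding `k - 1`, or avoiding both leaves a smaller
box. -/
lemma spanSum_eq_sub (N : (Fin 4 → ℤ) → ℤ) (k : ℕ) :
    spanSum N k = ∑ r ∈ Fintype.piFinset fun _ : Fin 4 => Ico (0 : ℤ) k, N r
      - ∑ r ∈ Fintype.piFinset fun _ : Fin 4 => Ico (1 : ℤ) k, N r
      - ∑ r ∈ Fintype.piFinset fun _ : Fin 4 => Ico (0 : ℤ) (k - 1), N r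
      + ∑ r ∈ Fintype.piFinset fun _ : Fin 4 => Ico (1 : ℤ) (k - 1), N r := by
  have e1 : (Fintype.piFinset fun _ : Fin 4 => Ico (1 : ℤ) k) =
      (Fintype.piFinset fun _ : Fin 4 => Ico (0 : ℤ) k).filter fun r => ¬ ∃ x, r x = 0 := by
    ext r
    simp only [mem_filter, Fintype.mem_piFinset, mem_Ico, not_exists, ← forall_and]
    exact forall_congr' fun x => by omega
  have e2 : (Fintype.piFinset fun _ : Fin 4 => Ico (0 : ℤ) (k - 1)) =
      (Fintype.piFinset fun _ : Fin 4 => Ico (0 : ℤ) k).filter fun r => ¬ ∃ x, r x + 1 = (k : ℤ) := by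
    ext r
    simp only [mem_filter, Fintype.mem_piFinset, mem_Ico, not_exists, ← forall_and]
    exact forall_congr' fun x => by omega
  have e3 : (Fintype.piFinset fun _ : Fin 4 => Ico (1 : ℤ) (k - 1)) =
      (Fintype.piFinset fun _ : Fin 4 => Ico (0 : ℤ) k).filter
        fun r => (¬ ∃ x, r x = 0) ∧ ¬ ∃ x, r x + 1 = (k : ℤ) := by
    ext r
    simp only [mem_filter, Fintype.mem_piFinset, mem_Ico, not_exists, ← forall_and]
    exact forall_congr' fun x => by omega
  rw [e1, e2, e3, spanSum]
  simp only [sum_filter, ← sum_sub_distrib, ← sum_add_distrib]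
  refine Finset.sum_congr rfl fun r _ => ?_
  by_cases h1 : ∃ x, r x = 0 <;> by_cases h2 : ∃ x, r x + 1 = (k : ℤ) <;>
    simp only [h1, h2, if_true, if_false, and_true, and_false, not_true, not_false_iff] <;> ring

lemma sum_sum_eq_diag_add {A : Finset ℤ} (g : ℤ → ℤ → ℤ) :
    ∑ a ∈ A, ∑ b ∈ A, g a b =
      ∑ a ∈ A, g a a + ∑ a ∈ A, ∑ b ∈ A with a < b, (g a b + g b a) := by
  have h1 : ∀ a ∈ A, ∑ b ∈ A, g a b = g a a + (∑ b ∈ A with a < b, g a b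
      + ∑ b ∈ A with b < a, g a b) := by
    intro a ha
    simp only [sum_filter]
    rw [← sum_add_distrib, ← Finset.sum_erase_add A _ ha, ← Finset.sum_erase_add A _ ha]
    simp only [lt_irrefl, if_false, add_zero]
    rw [add_comm]
    congr 1
    refine Finset.sum_congr rfl fun b hb => ?_
    rcases lt_or_gt_of_ne (ne_of_mem_erase hb) with h | h
    · simp [h, h.not_gt]
    · simp [h, h.not_gt]
  rw [sum_congr rfl h1, sum_add_distrib]
  congr 1
  simp only [sum_add_distrib]
  congr 1
  simp only [sum_filter]
  rw [sum_comm]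

/-- The classification of the quadruples with minimum `0` and maximum `k - 1`, up to rotation and
reversal. -/
lemma spanSum_eq {N : (Fin 4 → ℤ) → ℤ} {f : ℤ → ℤ → ℤ → ℤ → ℤ}
    (hf : ∀ a b c d, N ![a, b, c, d] = f a b c d)
    (hrot : ∀ a b c d, f b c d a = f a b c d) (hrefl : ∀ a b c d, f d c b a = f a b c d)
    {k : ℕ} (hk : 2 ≤ k) :
    spanSum N k = 4 * (f 0 0 0 (k - 1) + f (k - 1) (k - 1) (k - 1) 0 + f 0 0 (k - 1) (k - 1))
        + 2 * f 0 (k - 1) 0 (k - 1)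
      + ∑ h ∈ Ico (1 : ℤ) (k - 1),
        (8 * (f 0 0 h (k - 1) + f h h 0 (k - 1) + f (k - 1) (k - 1) 0 h)
          + 4 * (f 0 h 0 (k - 1) + f h 0 h (k - 1) + f (k - 1) 0 (k - 1) h))
      + ∑ h ∈ Ico (1 : ℤ) (k - 1), ∑ w ∈ Ico (1 : ℤ) (k - 1) with h < w,
        8 * (f 0 h w (k - 1) + f 0 w h (k - 1) + f 0 h (k - 1) w) := by
  -- The seven non-trivial dihedral symmetries. As ordered rewrite rules for `simp` they identify
  -- the values of `f` on an orbit.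
  have d1 : ∀ a b c d, f a b c d = f b c d a := fun a b c d => (hrot a b c d).symm
  have d2 : ∀ a b c d, f a b c d = f c d a b := fun a b c d => by rw [d1, d1]
  have d3 : ∀ a b c d, f a b c d = f d a b c := fun a b c d => hrot d a b c
  have d4 : ∀ a b c d, f a b c d = f d c b a := fun a b c d => (hrefl a b c d).symm
  have d5 : ∀ a b c d, f a b c d = f c b a d := fun a b c d => by rw [d4, d1]
  have d6 : ∀ a b c d, f a b c d = f b a d c := fun a b c d => by rw [d4, d2]
  have d7 : ∀ a b c d, f a b c d = f a d c b := fun a b c d => by rw [d4, d3]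
  -- Each coordinate is `0`, `k - 1` or strictly between; `s1`, `s2` and `s3` split off the extreme
  -- values present in each range.
  have s1 : ∀ g : ℤ → ℤ, ∑ a ∈ Ico (0 : ℤ) k, g a =
      g 0 + (g (k - 1) + ∑ a ∈ Ico (1 : ℤ) (k - 1), g a) := by
    intro g
    have e1 : Ico (0 : ℤ) k = insert 0 (insert ((k : ℤ) - 1) (Ico (1 : ℤ) (k - 1))) := by
      ext x; simp only [mem_Ico, mem_insert]; omega
    rw [e1, sum_insert, sum_insert] <;> simp
    omega
  have s2 : ∀ g : ℤ → ℤ, ∑ a ∈ Ico (1 : ℤ) k, g a =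
      g (k - 1) + ∑ a ∈ Ico (1 : ℤ) (k - 1), g a := by
    intro g
    have e1 : Ico (1 : ℤ) k = insert ((k : ℤ) - 1) (Ico (1 : ℤ) (k - 1)) := by
      ext x; simp only [mem_Ico, mem_insert]; omega
    rw [e1, sum_insert]
    simp
  have s3 : ∀ g : ℤ → ℤ, ∑ a ∈ Ico (0 : ℤ) (k - 1), g a =
      g 0 + ∑ a ∈ Ico (1 : ℤ) (k - 1), g a := by
    intro g
    have e1 : Ico (0 : ℤ) (k - 1) = insert 0 (Ico (1 : ℤ) (k - 1)) := by
      ext x; simp only [mem_Ico, mem_insert]; omega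
    rw [e1, sum_insert]
    simp
  rw [spanSum_eq_sub]
  simp only [sum_piFinset_four, hf]
  generalize hK : (k : ℤ) - 1 = K at *
  generalize hM : Ico (1 : ℤ) K = M at *
  -- The 24 arrangements with a single inner entry are separated from the 12 containing `h` twice.
  -- The latter are the diagonal of the double sum over two inner entries in `step4`.
  have step : ∑ h ∈ M, (8 * (f 0 0 h K + f h h 0 K + f K K 0 h)
          + 4 * (f 0 h 0 K + f h 0 h K + f K 0 K h)) =
      ∑ h ∈ M, (f h 0 0 K + f h 0 K 0 + f h K 0 0 + f h K K 0 + f h K 0 K + f h 0 K K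
        + f 0 h 0 K + f 0 h K 0 + f K h 0 0 + f K h K 0 + f K h 0 K + f 0 h K K
        + f 0 0 h K + f 0 K h 0 + f K 0 h 0 + f K K h 0 + f K 0 h K + f 0 K h K
        + f 0 0 K h + f 0 K 0 h + f K 0 0 h + f K K 0 h + f K 0 K h + f 0 K K h)
      + ∑ h ∈ M, (f 0 K h h + f K 0 h h + f 0 h K h + f K h 0 h + f 0 h h K + f K h h 0
        + f h 0 K h + f h K 0 h + f h 0 h K + f h K h 0 + f h h 0 K + f h h K 0) := by
    rw [← sum_add_distrib]
    refine Finset.sum_congr rfl fun h _ => ?_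
    simp only [d1, d2, d3, d6, d7]
    ring
  have step2 : ∑ h ∈ M, ∑ w ∈ M with h < w, 8 * (f 0 h w K + f 0 w h K + f 0 h K w) =
      ∑ h ∈ M, ∑ w ∈ M with h < w, ((f 0 K h w + f K 0 h w + f 0 h K w + f K h 0 w + f 0 h w K
        + f K h w 0 + f h 0 K w + f h K 0 w + f h 0 w K + f h K w 0 + f h w 0 K + f h w K 0)
        + (f 0 K w h + f K 0 w h + f 0 w K h + f K w 0 h + f 0 w h K
        + f K w h 0 + f w 0 K h + f w K 0 h + f w 0 h K + f w K h 0 + f w h 0 K + f w h K 0)) := by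
    refine Finset.sum_congr rfl fun h _ => Finset.sum_congr rfl fun w _ => ?_
    simp only [d1, d2, d3, d7]
    ring
  have step3 : 4 * (f 0 0 0 K + f K K K 0 + f 0 0 K K) + 2 * f 0 K 0 K =
      f 0 0 0 K + f 0 0 K 0 + f 0 K 0 0 + f K 0 0 0 + f K K K 0 + f K K 0 K + f K 0 K K + f 0 K K K
      + f 0 0 K K + f 0 K K 0 + f K K 0 0 + f K 0 0 K + f 0 K 0 K + f K 0 K 0 := by
    simp only [d1, d2, d3]
    ring
  have step4 := sum_sum_eq_diag_add (A := M) (fun h w =>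
    f 0 K h w + f K 0 h w + f 0 h K w + f K h 0 w + f 0 h w K
        + f K h w 0 + f h 0 K w + f h K 0 w + f h 0 w K + f h K w 0 + f h w 0 K + f h w K 0)
  rw [step, step2, step3]
  simp only [s1, s2, s3, sum_add_distrib] at step4 ⊢
  linear_combination step4

lemma spanSum_one (N : (Fin 4 → ℤ) → ℤ) : spanSum N 1 = N ![0, 0, 0, 0] := by
  rw [spanSum_eq_sub]
  simp only [sum_piFinset_four]
  have : Ico (0 : ℤ) 1 = {0} := by decide
  simp [this]

end Classification

/-! ### Counting tuples of distinct elements of given sets. -/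

section InjectiveTuples

lemma injective_cons_four_iff {α : Type*} {a b c d : α} : Function.Injective ![a, b, c, d] ↔
    (a ≠ b ∧ a ≠ c ∧ b ≠ c) ∧ a ≠ d ∧ b ≠ d ∧ c ≠ d := by
  constructor
  · intro h
    have key : ∀ x y : Fin 4, x ≠ y → ![a, b, c, d] x ≠ ![a, b, c, d] y := fun x y => h.ne
    exact ⟨⟨key 0 1 (by decide), key 0 2 (by decide), key 1 2 (by decide)⟩,
      key 0 3 (by decide), key 1 3 (by decide), key 2 3 (by decide)⟩
  · rintro ⟨⟨h1, h2, h3⟩, h4, h5, h6⟩ x y hxy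
    fin_cases x <;> fin_cases y <;> simp_all

variable {α : Type*} [DecidableEq α]

/-- The number of pairs of distinct elements of two sets. -/
def injPairs (A B : Finset α) : ℤ := ∑ a ∈ A, ∑ b ∈ B, if a ≠ b then 1 else 0

/-- The number of triples of distinct elements of three sets. -/
def injTriples (A B C : Finset α) : ℤ :=
  ∑ a ∈ A, ∑ b ∈ B, ∑ c ∈ C, if a ≠ b ∧ a ≠ c ∧ b ≠ c then 1 else 0

/-- The number of quadruples of distinct elements of four sets. -/
def injQuadruples (A B C D : Finset α) : ℤ :=
  ∑ a ∈ A, ∑ b ∈ B, ∑ c ∈ C, ∑ d ∈ D,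
    if (a ≠ b ∧ a ≠ c ∧ b ≠ c) ∧ a ≠ d ∧ b ≠ d ∧ c ≠ d then 1 else 0

lemma injPairs_eq (A B : Finset α) : injPairs A B = #A * #B - #(A ∩ B) := by
  have h : ∀ a ∈ A, ∑ b ∈ B, (if a ≠ b then 1 else 0 : ℤ) = #B - if a ∈ B then 1 else 0 := by
    intro a _
    rw [← Finset.sum_ite_eq B a fun _ => (1 : ℤ), card_eq_sum_ones, Nat.cast_sum, ← sum_sub_distrib]
    refine sum_congr rfl fun b _ => ?_
    by_cases h : a = b <;> simp [h]
  rw [injPairs, sum_congr rfl h, sum_sub_distrib, sum_const, nsmul_eq_mul, ← sum_filter,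
    filter_mem_eq_inter]
  simp

/-- Once `a ≠ b` are chosen, `c` has to avoid two different values, each of which costs one choice
exactly if it lies in `C`. The recursion for quadruples works in the same way. -/
lemma injTriples_eq (A B C : Finset α) : injTriples A B C =
    #C * injPairs A B - injPairs (A ∩ C) B - injPairs A (B ∩ C) := by
  have h : ∀ a ∈ A, ∀ b ∈ B, ∑ c ∈ C, (if a ≠ b ∧ a ≠ c ∧ b ≠ c then 1 else 0 : ℤ) =
      #C * (if a ≠ b then 1 else 0) - (if a ∈ C then if a ≠ b then 1 else 0 else 0)
        - (if b ∈ C then if a ≠ b then 1 else 0 else 0) := by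
    intro a _ b _
    rw [← Finset.sum_ite_eq C a fun _ => (if a ≠ b then 1 else 0 : ℤ),
      ← Finset.sum_ite_eq C b fun _ => (if a ≠ b then 1 else 0 : ℤ),
      card_eq_sum_ones, Nat.cast_sum, sum_mul, ← sum_sub_distrib, ← sum_sub_distrib]
    refine sum_congr rfl fun c _ => ?_
    by_cases hab : a = b
    · simp [hab]
    · by_cases hac : a = c
      · subst hac
        simp [hab, Ne.symm hab]
      · by_cases hbc : b = c <;> simp [hab, hac, hbc]
  rw [injTriples, sum_congr rfl fun a ha => sum_congr rfl (h a ha)]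
  simp only [sum_sub_distrib, injPairs, ← filter_mem_eq_inter, sum_filter, mul_sum]
  congr 2
  refine sum_congr rfl fun a _ => ?_
  split_ifs <;> simp

lemma injQuadruples_eq (A B C D : Finset α) : injQuadruples A B C D =
    #D * injTriples A B C - injTriples (A ∩ D) B C - injTriples A (B ∩ D) C
      - injTriples A B (C ∩ D) := by
  have h : ∀ a ∈ A, ∀ b ∈ B, ∀ c ∈ C, ∑ d ∈ D,
      (if (a ≠ b ∧ a ≠ c ∧ b ≠ c) ∧ a ≠ d ∧ b ≠ d ∧ c ≠ d then 1 else 0 : ℤ) =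
      #D * (if a ≠ b ∧ a ≠ c ∧ b ≠ c then 1 else 0)
        - (if a ∈ D then if a ≠ b ∧ a ≠ c ∧ b ≠ c then 1 else 0 else 0)
        - (if b ∈ D then if a ≠ b ∧ a ≠ c ∧ b ≠ c then 1 else 0 else 0)
        - (if c ∈ D then if a ≠ b ∧ a ≠ c ∧ b ≠ c then 1 else 0 else 0) := by
    intro a _ b _ c _
    rw [← Finset.sum_ite_eq D a fun _ => (if a ≠ b ∧ a ≠ c ∧ b ≠ c then 1 else 0 : ℤ),
      ← Finset.sum_ite_eq D b fun _ => (if a ≠ b ∧ a ≠ c ∧ b ≠ c then 1 else 0 : ℤ),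
      ← Finset.sum_ite_eq D c fun _ => (if a ≠ b ∧ a ≠ c ∧ b ≠ c then 1 else 0 : ℤ),
      card_eq_sum_ones, Nat.cast_sum, sum_mul, ← sum_sub_distrib, ← sum_sub_distrib,
      ← sum_sub_distrib]
    refine sum_congr rfl fun d _ => ?_
    by_cases habc : a ≠ b ∧ a ≠ c ∧ b ≠ c
    · obtain ⟨hab, hac, hbc⟩ := habc
      by_cases had : a = d
      · subst had
        simp [hab, hac, hbc, Ne.symm hab, Ne.symm hac]
      · by_cases hbd : b = d
        · subst hbd
          simp [hab, hac, hbc, Ne.symm hbc]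
        · by_cases hcd : c = d <;> simp [hab, hac, hbc, had, hbd, hcd]
    · simp [habc]
  rw [injQuadruples, sum_congr rfl fun a ha => sum_congr rfl fun b hb => sum_congr rfl (h a ha b hb)]
  simp only [sum_sub_distrib, injTriples, ← filter_mem_eq_inter, sum_filter, mul_sum]
  congr 2
  · congr 1
    refine sum_congr rfl fun a _ => ?_
    split_ifs <;> simp
  · refine sum_congr rfl fun a _ => sum_congr rfl fun b _ => ?_
    split_ifs <;> simp

lemma card_injective_piFinset (B : Fin 4 → Finset α) :
    (#{f ∈ Fintype.piFinset B | Function.Injective f} : ℤ) =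
      injQuadruples (B 0) (B 1) (B 2) (B 3) := by
  classical
  rw [card_filter, Nat.cast_sum, sum_piFinset_four]
  simp only [injective_cons_four_iff, Nat.cast_ite, Nat.cast_one, Nat.cast_zero]
  rfl

end InjectiveTuples

/-! ### Overlap parameters as cardinalities of sets of columns. -/

section Columns

/-- The columns of replica `r` of the doubly infinite SC code that have a `1` in all the rows
of `I`. -/
noncomputable def colSet (P : Partitioning γ κ m) (r : ℤ) (I : Finset ℤ) : Finset (ℤ × Fin κ) :=
  open Classical in
  (univ.filter fun j => ∀ i ∈ I, Adj P i r j).map ⟨fun j => (r, j), Prod.mk_right_injective r⟩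

lemma mem_colSet {P : Partitioning γ κ m} {r : ℤ} {I : Finset ℤ} {v : ℤ × Fin κ} :
    v ∈ colSet P r I ↔ v.1 = r ∧ ∀ i ∈ I, Adj P i r v.2 := by
  obtain ⟨s, j⟩ := v
  simp [colSet]
  tauto

lemma colSet_inter (P : Partitioning γ κ m) (r : ℤ) (I J : Finset ℤ) :
    colSet P r I ∩ colSet P r J = colSet P r (I ∪ J) := by
  ext v
  simp only [mem_inter, mem_colSet, mem_union, or_imp, forall_and]
  tauto

lemma colSet_inter_of_ne (P : Partitioning γ κ m) {r s : ℤ} (h : r ≠ s) (I J : Finset ℤ) :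
    colSet P r I ∩ colSet P s J = ∅ := by
  ext v
  simp only [mem_inter, mem_colSet, notMem_empty, iff_false]
  rintro ⟨⟨h1, -⟩, h2, -⟩
  exact h (h1.symm.trans h2)

/-- In replica `r`, row `i` is the stacked row `i - r * γ`. Naming the replica `-d` thus gives the
shift `+ d * γ` of the formulas. -/
lemma card_colSet (P : Partitioning γ κ m) (d : ℤ) (I : Finset ℤ) :
    (#(colSet P (-d) I) : ℤ) = P.overlap (I.image fun i => i + d * γ) := by
  classical
  rw [colSet, card_map, Partitioning.overlap]
  congr 2
  ext j
  simp only [mem_filter, mem_univ, true_and, forall_mem_image]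
  refine forall₂_congr fun i _ => exists_congr fun a => ?_
  rw [neg_mul, sub_neg_eq_add]

lemma card_colSet_zero (P : Partitioning γ κ m) (I : Finset ℤ) :
    (#(colSet P 0 I) : ℤ) = P.overlap I := by
  simpa using card_colSet P 0 I

lemma card_colSet_mono (P : Partitioning γ κ m) (r : ℤ) {I J : Finset ℤ} (h : I ⊆ J) :
    (#(colSet P r J) : ℤ) ≤ #(colSet P r I) := by
  refine Nat.cast_le.2 (card_le_card fun v hv => ?_)
  rw [mem_colSet] at hv ⊢
  exact ⟨hv.1, fun i hi => hv.2 i (h hi)⟩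

/-- Columns containing `I` or `J` all contain `K`, and those containing both contain `M`; now count
a union and an intersection. -/
lemma card_colSet_add_le (P : Partitioning γ κ m) (r : ℤ) {I J K M : Finset ℤ} (hI : K ⊆ I)
    (hJ : K ⊆ J) (hM : I ∪ J = M) :
    (#(colSet P r I) : ℤ) + #(colSet P r J) ≤ #(colSet P r K) + #(colSet P r M) := by
  rw [← hM, ← colSet_inter, ← Nat.cast_add, ← Nat.cast_add, ← card_union_add_card_inter]
  refine Nat.cast_le.2 (Nat.add_le_add_right (card_le_card fun v hv => ?_) _)
  rw [mem_union, mem_colSet, mem_colSet] at hv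
  rw [mem_colSet]
  rcases hv with hv | hv
  exacts [⟨hv.1, fun i hi => hv.2 i (hI hi)⟩, ⟨hv.1, fun i hi => hv.2 i (hJ hi)⟩]

end Columns

/-! ### Ordered cycles through fixed rows. -/

section CyclesThroughRows

open Classical in
/-- The number of ordered cycles through given rows whose columns lie in given replicas. -/
noncomputable def cyclesAt (P : Partitioning γ κ m) (r i : Fin 4 → ℤ) : ℕ :=
  #{j : Fin 4 → Fin κ | IsCodeCycle P r i j}

lemma cyclesAt_rot (P : Partitioning γ κ m) (r i : Fin 4 → ℤ) :
    cyclesAt P (r ∘ rot) (i ∘ rot) = cyclesAt P r i := by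
  classical
  exact (Finset.card_equiv (rot.symm.arrowCongr (Equiv.refl _)) fun j => by
    simp only [mem_filter, mem_univ, true_and]; exact isCodeCycle_rot P r i j).symm

lemma cyclesAt_refl (P : Partitioning γ κ m) (r i : Fin 4 → ℤ) :
    cyclesAt P (r ∘ reflCol) (i ∘ reflRow) = cyclesAt P r i := by
  classical
  exact (Finset.card_equiv (reflCol.symm.arrowCongr (Equiv.refl _)) fun j => by
    simp only [mem_filter, mem_univ, true_and]; exact isCodeCycle_refl P r i j).symm

lemma comp_rot {α : Type*} (a b c d : α) : ![a, b, c, d] ∘ rot = ![b, c, d, a] := by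
  ext x; fin_cases x <;> rfl

lemma comp_reflRow {α : Type*} (a b c d : α) : ![a, b, c, d] ∘ reflRow = ![a, d, c, b] := by
  ext x; fin_cases x <;> rfl

lemma comp_reflCol {α : Type*} (a b c d : α) : ![a, b, c, d] ∘ reflCol = ![d, c, b, a] := by
  ext x; fin_cases x <;> rfl

/-- This reflection fixes two opposite rows, as does `cyclesAt_swap13`, whereas
`cyclesAt_swap14_swap23` fixes two opposite columns. If the replica pattern is unchanged, they
become symmetries of the summand. -/
lemma cyclesAt_swap24 (P : Partitioning γ κ m) (r₁ r₂ r₃ r₄ i₁ i₂ i₃ i₄ : ℤ) :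
    cyclesAt P ![r₄, r₃, r₂, r₁] ![i₁, i₄, i₃, i₂] =
      cyclesAt P ![r₁, r₂, r₃, r₄] ![i₁, i₂, i₃, i₄] := by
  have := cyclesAt_refl P ![r₁, r₂, r₃, r₄] ![i₁, i₂, i₃, i₄]
  rwa [comp_reflCol, comp_reflRow] at this

lemma cyclesAt_swap14_swap23 (P : Partitioning γ κ m) (r₁ r₂ r₃ r₄ i₁ i₂ i₃ i₄ : ℤ) :
    cyclesAt P ![r₃, r₂, r₁, r₄] ![i₄, i₃, i₂, i₁] =
      cyclesAt P ![r₁, r₂, r₃, r₄] ![i₁, i₂, i₃, i₄] := by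
  rw [← cyclesAt_swap24 P r₁, ← cyclesAt_rot P ![r₄, _, _, _], comp_rot, comp_rot]

lemma cyclesAt_swap13 (P : Partitioning γ κ m) (r₁ r₂ r₃ r₄ i₁ i₂ i₃ i₄ : ℤ) :
    cyclesAt P ![r₂, r₁, r₄, r₃] ![i₃, i₂, i₁, i₄] =
      cyclesAt P ![r₁, r₂, r₃, r₄] ![i₁, i₂, i₃, i₄] := by
  rw [← cyclesAt_swap14_swap23 P r₁, ← cyclesAt_rot P ![r₃, _, _, _], comp_rot, comp_rot]

/-- Two rows of a common column lie in different residue classes modulo `γ`. -/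
lemma Adj.emod_ne {P : Partitioning γ κ m} {i i' r : ℤ} {j : Fin κ} (h : Adj P i r j)
    (h' : Adj P i' r j) (hne : i ≠ i') : i % γ ≠ i' % γ := by
  intro hmod
  obtain ⟨a, ha, h1⟩ := h
  obtain ⟨a', ha', h1'⟩ := h'
  apply hne
  have hmodNat : a.modNat = a'.modNat := by
    refine Fin.ext ?_
    change a.val % γ = a'.val % γ
    zify
    rw [ha, ha', Int.sub_mul_emod_self_right, Int.sub_mul_emod_self_right, hmod]
  have hdivNat : a.divNat = a'.divNat := by
    -- Two ones in different component matrices at the same position would contradict that the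
    -- entries there sum to `1`.
    by_contra hne
    have hsum := P.sum_eq_one a.modNat j
    have hle := Finset.sum_le_sum_of_subset (f := fun y => P.comp y a.modNat j)
      (Finset.subset_univ {a.divNat, a'.divNat})
    rw [sum_pair hne, hsum] at hle
    unfold Partitioning.stacked at h1 h1'
    rw [← hmodNat] at h1'
    omega
  have : a = a' := finProdFinEquiv.symm.injective (Prod.ext hdivNat hmodNat)
  subst this
  linarith

lemma IsCodeCycle.adm {P : Partitioning γ κ m} {r i : Fin 4 → ℤ} {j : Fin 4 → Fin κ}
    (h : IsCodeCycle P r i j) : Adm γ (i 0) (i 1) (i 2) (i 3) := by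
  have key : ∀ x : Fin 4, i x % γ ≠ i (x + 1) % γ := fun x =>
    (h.2.2 x).1.emod_ne (h.2.2 x).2 (h.1.ne (by revert x; decide))
  exact ⟨key 0, h.1.ne (by decide), (key 3).symm, key 1, h.1.ne (by decide), key 2⟩

lemma cyclesAt_eq_zero (P : Partitioning γ κ m) (r : Fin 4 → ℤ) {i₁ i₂ i₃ i₄ : ℤ}
    (h : ¬ Adm γ i₁ i₂ i₃ i₄) : cyclesAt P r ![i₁, i₂, i₃, i₄] = 0 := by
  classical
  unfold cyclesAt
  rw [card_eq_zero, filter_eq_empty_iff]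
  exact fun j _ hj => h hj.adm

/-- Admissibility makes the rows distinct. Adjacency places each column, together with its replica,
in the common columns of its two rows, and only the distinctness of the columns remains. -/
lemma cyclesAt_eq (P : Partitioning γ κ m) (r₁ r₂ r₃ r₄ : ℤ) {i₁ i₂ i₃ i₄ : ℤ}
    (h : Adm γ i₁ i₂ i₃ i₄) : (cyclesAt P ![r₁, r₂, r₃, r₄] ![i₁, i₂, i₃, i₄] : ℤ) =
      injQuadruples (colSet P r₁ {i₁, i₂}) (colSet P r₂ {i₂, i₃}) (colSet P r₃ {i₃, i₄})
        (colSet P r₄ {i₁, i₄}) := by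
  classical
  have hi : Function.Injective ![i₁, i₂, i₃, i₄] := by
    obtain ⟨h1, h2, h3, h4, h5, h6⟩ := h
    rw [injective_cons_four_iff]
    refine ⟨⟨?_, h2, ?_⟩, ?_, h5, ?_⟩ <;> rintro rfl <;> contradiction
  have := card_injective_piFinset ![colSet P r₁ {i₁, i₂}, colSet P r₂ {i₂, i₃},
    colSet P r₃ {i₃, i₄}, colSet P r₄ {i₁, i₄}]
  refine Eq.trans ?_ this
  rw [cyclesAt, Nat.cast_inj]
  refine Finset.card_nbij' (fun j x => (![r₁, r₂, r₃, r₄] x, j x)) (fun f x => (f x).2) ?_ ?_ ?_ ?_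
  · intro j hj
    simp only [coe_filter, mem_univ, true_and, Set.mem_ofPred_eq] at hj
    simp only [coe_filter, Set.mem_ofPred_eq, Fintype.mem_piFinset]
    refine ⟨fun x => ?_, hj.2.1⟩
    have h0 := hj.2.2 x
    fin_cases x <;> simpa [mem_colSet, and_comm] using h0
  · intro f hf
    simp only [coe_filter, Set.mem_ofPred_eq, Fintype.mem_piFinset] at hf
    simp only [coe_filter, mem_univ, true_and, Set.mem_ofPred_eq]
    obtain ⟨hf, hinj⟩ := hf
    have hr : ∀ x, (f x).1 = ![r₁, r₂, r₃, r₄] x := by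
      intro x
      have h0 := hf x
      fin_cases x <;> exact (mem_colSet.1 h0).1
    refine ⟨hi, ?_, fun x => ?_⟩
    · intro x y hxy
      simp only [← hr] at hxy
      exact hinj hxy
    · have h0 := hf x
      fin_cases x <;> simpa [mem_colSet, and_comm] using (mem_colSet.1 h0).2
  · intro j _; rfl
  · intro f hf
    simp only [coe_filter, Set.mem_ofPred_eq, Fintype.mem_piFinset] at hf
    funext x
    have h0 := hf.1 x
    refine Prod.ext ?_ rfl
    fin_cases x <;> exact (mem_colSet.1 h0).1.symm

lemma numCycles_eq_sum (P : Partitioning γ κ m) {r : Fin 4 → ℤ} (B : Fin 4 → Finset ℤ)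
    (hB : ∀ i j, IsCodeCycle P r i j → ∀ x, i x ∈ B x) :
    numCycles P r = ∑ i ∈ Fintype.piFinset B, cyclesAt P r i := by
  classical
  have : {p : (Fin 4 → ℤ) × (Fin 4 → Fin κ) | IsCodeCycle P r p.1 p.2} =
      ↑((Fintype.piFinset B ×ˢ univ).filter fun p : (Fin 4 → ℤ) × (Fin 4 → Fin κ) =>
        IsCodeCycle P r p.1 p.2) := by
    ext p
    simp only [Set.mem_ofPred_eq, coe_filter, mem_product, Fintype.mem_piFinset, mem_univ, and_true]
    exact ⟨fun h => ⟨hB _ _ h, h⟩, fun h => h.2⟩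
  rw [numCycles, this, Set.ncard_coe_finset, card_filter, sum_product]
  refine sum_congr rfl fun i _ => ?_
  rw [cyclesAt, card_filter]

/-- The number of ordered cycles whose columns lie in given replicas, as a sum over rows. -/
lemma numCycles_eq_sumAll (P : Partitioning γ κ m) {r₁ r₂ r₃ r₄ a₁ a₂ a₃ a₄ b₁ b₂ b₃ b₄ : ℤ}
    (ha₁ : a₁ ≤ r₁ ∨ a₁ ≤ r₄) (ha₂ : a₂ ≤ r₁ ∨ a₂ ≤ r₂) (ha₃ : a₃ ≤ r₂ ∨ a₃ ≤ r₃)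
    (ha₄ : a₄ ≤ r₃ ∨ a₄ ≤ r₄) (hb₁ : r₁ + m + 1 ≤ b₁ ∨ r₄ + m + 1 ≤ b₁)
    (hb₂ : r₁ + m + 1 ≤ b₂ ∨ r₂ + m + 1 ≤ b₂) (hb₃ : r₂ + m + 1 ≤ b₃ ∨ r₃ + m + 1 ≤ b₃)
    (hb₄ : r₃ + m + 1 ≤ b₄ ∨ r₄ + m + 1 ≤ b₄) :
    (numCycles P ![r₁, r₂, r₃, r₄] : ℤ) =
      sumAll γ (rng γ a₁ b₁) (rng γ a₂ b₂) (rng γ a₃ b₃) (rng γ a₄ b₄) fun i₁ i₂ i₃ i₄ =>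
        cyclesAt P ![r₁, r₂, r₃, r₄] ![i₁, i₂, i₃, i₄] := by
  -- A row of a cycle lies in the windows of both its columns. Each endpoint of its range may
  -- therefore come from either window, whence the disjunctive hypotheses.
  have hmem : ∀ {i a b r s : ℤ}, (a ≤ r ∨ a ≤ s) → (r + m + 1 ≤ b ∨ s + m + 1 ≤ b) →
      (r * γ ≤ i ∧ i < (r + m + 1) * γ) → (s * γ ≤ i ∧ i < (s + m + 1) * γ) → i ∈ rng γ a b := by
    intro i a b r s ha hb hr hs
    rw [mem_Ico]
    constructor
    · rcases ha with h | h
      exacts [(mul_le_mul_of_nonneg_right h (by positivity)).trans hr.1,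
        (mul_le_mul_of_nonneg_right h (by positivity)).trans hs.1]
    · rcases hb with h | h
      exacts [hr.2.trans_le (mul_le_mul_of_nonneg_right h (by positivity)),
        hs.2.trans_le (mul_le_mul_of_nonneg_right h (by positivity))]
  rw [numCycles_eq_sum P ![rng γ a₁ b₁, rng γ a₂ b₂, rng γ a₃ b₃, rng γ a₄ b₄], Nat.cast_sum,
    sum_piFinset_four]
  · refine sum_congr rfl fun i₁ _ => sum_congr rfl fun i₂ _ => sum_congr rfl fun i₃ _ =>
      sum_congr rfl fun i₄ _ => ?_
    split_ifs with h
    · rfl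
    · rw [cyclesAt_eq_zero P _ h, Nat.cast_zero]
  · intro i j h
    have h0 := h.2.2
    intro x
    fin_cases x
    · exact hmem ha₁ hb₁ (h0 0).1.bounds (h0 3).2.bounds
    · exact hmem ha₂ hb₂ (h0 0).2.bounds (h0 1).1.bounds
    · exact hmem ha₃ hb₃ (h0 1).2.bounds (h0 2).1.bounds
    · exact hmem ha₄ hb₄ (h0 2).2.bounds (h0 3).1.bounds

end CyclesThroughRows

/-! ### Inclusion-exclusion polynomials and removal of the positive parts. -/

section MoebiusForm

/-- Möbius inversion over the partitions of four positions: blocks of size 1, 2, 3, 4 contribute the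
factors 1, -1, 2, -6. -/
lemma injQuadruples_eq_card {α : Type*} [DecidableEq α] (A B C D : Finset α) :
    injQuadruples A B C D = #A * #B * #C * #D
      - (#(A ∩ B) * #C * #D + #(A ∩ C) * #B * #D + #(A ∩ D) * #B * #C
        + #(B ∩ C) * #A * #D + #(B ∩ D) * #A * #C + #(C ∩ D) * #A * #B)
      + (#(A ∩ B) * #(C ∩ D) + #(A ∩ C) * #(B ∩ D) + #(A ∩ D) * #(B ∩ C))
      + 2 * (#(A ∩ B ∩ C) * #D + #(A ∩ B ∩ D) * #C + #(A ∩ C ∩ D) * #B + #(B ∩ C ∩ D) * #A)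
      - 6 * #(A ∩ B ∩ C ∩ D) := by
  simp only [injQuadruples_eq, injTriples_eq, injPairs_eq, inter_comm, inter_left_comm]
  ring

lemma mul_posPart_eq {x y : ℤ} (h : y < 0 → x = 0) : x * y⁺ = x * y := by
  rcases lt_or_ge y 0 with hy | hy
  · rw [h hy, zero_mul, zero_mul]
  · rw [posPart_of_nonneg hy]

/-- The inequalities between overlap parameters that the closed formulas rely on. -/
structure OverlapIneqs (t12 t23 t34 t14 t123 t124 t134 t234 t1234 : ℤ) : Prop where
  nonneg : 0 ≤ t1234
  le123 : t1234 ≤ t123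
  le124 : t1234 ≤ t124
  le134 : t1234 ≤ t134
  le234 : t1234 ≤ t234
  le12 : t123 ≤ t12
  le12' : t124 ≤ t12
  le23 : t123 ≤ t23
  le23' : t234 ≤ t23
  le34 : t134 ≤ t34
  le34' : t234 ≤ t34
  le14 : t124 ≤ t14
  le14' : t134 ≤ t14
  add_le23 : t123 + t234 ≤ t23 + t1234
  add_le34 : t234 + t134 ≤ t34 + t1234
  add_le14 : t124 + t134 ≤ t14 + t1234

variable {t12 t23 t34 t14 t123 t124 t134 t234 t1234 : ℤ}

/-- If the argument of a positive part is negative, too few columns are left for the next choice,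
and the inequalities force an earlier factor to vanish. Without positive parts this is a polynomial
identity. -/
lemma fA_eq (h : OverlapIneqs t12 t23 t34 t14 t123 t124 t134 t234 t1234) :
    fA t12 t23 t34 t14 t123 t124 t134 t234 t1234 = t12 * t23 * t34 * t14
      - (t123 * t34 * t14 + t1234 * t23 * t14 + t124 * t23 * t34
        + t234 * t12 * t14 + t1234 * t12 * t34 + t134 * t12 * t23)
      + (t123 * t134 + t1234 * t1234 + t124 * t234)
      + 2 * (t1234 * t14 + t1234 * t34 + t1234 * t23 + t1234 * t12) - 6 * t1234 := by
  obtain ⟨_, _, _, _, _, _, _, _, _, _, _, _, _, _, _, _⟩ := h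
  unfold fA
  simp (disch := (intro _; first | omega | (simp only [mul_eq_zero]; omega))) only [mul_posPart_eq]
  ring

lemma fB_eq (h : OverlapIneqs t12 t23 t34 t14 t123 t124 t134 t234 t1234) (u14 : ℤ) :
    fB t12 t23 t34 t123 t234 t1234 u14 = (t12 * t23 * t34
      - (t123 * t34 + t1234 * t23 + t234 * t12) + 2 * t1234) * u14 := by
  obtain ⟨_, _, _, _, _, _, _, _, _, _, _, _, _, _, _, _⟩ := h
  unfold fB
  simp (disch := (intro _; first | omega | (simp only [mul_eq_zero]; omega))) only [mul_posPart_eq]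
  ring

lemma fC_eq (h : OverlapIneqs t12 t23 t34 t14 t123 t124 t134 t234 t1234)
    {u12 u23 u34 u14 u123 u124 u134 u234 u1234 : ℤ}
    (h' : OverlapIneqs u12 u23 u34 u14 u123 u124 u134 u234 u1234) :
    fC t12 t23 t123 u34 u14 u134 = (t12 * t23 - t123) * (u34 * u14 - u134) := by
  obtain ⟨_, _, _, _, _, _, _, _, _, _, _, _, _, _, _, _⟩ := h
  obtain ⟨_, _, _, _, _, _, _, _, _, _, _, _, _, _, _, _⟩ := h'
  unfold fC
  simp (disch := (intro _; omega)) only [mul_posPart_eq]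
  ring

lemma fD_eq (h : OverlapIneqs t12 t23 t34 t14 t123 t124 t134 t234 t1234)
    {u12 u23 u34 u14 u123 u124 u134 u234 u1234 : ℤ}
    (h' : OverlapIneqs u12 u23 u34 u14 u123 u124 u134 u234 u1234) :
    fD t12 t34 t1234 u23 u14 u1234 = (t12 * t34 - t1234) * (u23 * u14 - u1234) := by
  obtain ⟨_, _, _, _, _, _, _, _, _, _, _, _, _, _, _, _⟩ := h
  obtain ⟨_, _, _, _, _, _, _, _, _, _, _, _, _, _, _, _⟩ := h'
  unfold fD
  simp (disch := (intro _; omega)) only [mul_posPart_eq]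
  ring

lemma fE_eq (h : OverlapIneqs t12 t23 t34 t14 t123 t124 t134 t234 t1234) (u34 w14 : ℤ) :
    fE t12 t23 t123 u34 w14 = (t12 * t23 - t123) * u34 * w14 := by
  obtain ⟨_, _, _, _, _, _, _, _, _, _, _, _, _, _, _, _⟩ := h
  unfold fE
  simp (disch := (intro _; omega)) only [mul_posPart_eq]
  ring

lemma fG_eq (h : OverlapIneqs t12 t23 t34 t14 t123 t124 t134 t234 t1234) (u23 w14 : ℤ) :
    fG t12 t34 t1234 u23 w14 = (t12 * t34 - t1234) * u23 * w14 := by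
  obtain ⟨_, _, _, _, _, _, _, _, _, _, _, _, _, _, _, _⟩ := h
  unfold fG
  simp (disch := (intro _; omega)) only [mul_posPart_eq]
  ring

end MoebiusForm

/-! ### The number of cycles through fixed rows for each replica pattern. -/

section CyclesAtValues

variable (P : Partitioning γ κ m) {d d' d'' i₁ i₂ i₃ i₄ : ℤ}

lemma overlapIneqs_colSet (r i₁ i₂ i₃ i₄ : ℤ) :
    OverlapIneqs #(colSet P r {i₁, i₂}) #(colSet P r {i₂, i₃}) #(colSet P r {i₃, i₄})
      #(colSet P r {i₁, i₄}) #(colSet P r {i₁, i₂, i₃}) #(colSet P r {i₁, i₂, i₄})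
      #(colSet P r {i₁, i₃, i₄}) #(colSet P r {i₂, i₃, i₄}) #(colSet P r {i₁, i₂, i₃, i₄}) where
  nonneg := by positivity
  le123 := card_colSet_mono P r (by grind)
  le124 := card_colSet_mono P r (by grind)
  le134 := card_colSet_mono P r (by grind)
  le234 := card_colSet_mono P r (by grind)
  le12 := card_colSet_mono P r (by grind)
  le12' := card_colSet_mono P r (by grind)
  le23 := card_colSet_mono P r (by grind)
  le23' := card_colSet_mono P r (by grind)
  le34 := card_colSet_mono P r (by grind)
  le34' := card_colSet_mono P r (by grind)
  le14 := card_colSet_mono P r (by grind)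
  le14' := card_colSet_mono P r (by grind)
  add_le23 := card_colSet_add_le P r (by grind) (by grind) (by grind)
  add_le34 := card_colSet_add_le P r (by grind) (by grind) (by grind)
  add_le14 := card_colSet_add_le P r (by grind) (by grind) (by grind)

lemma card_colSet_pair (d a b : ℤ) :
    (#(colSet P (-d) {a, b}) : ℤ) = P.overlap {a + d * γ, b + d * γ} := by
  simp only [card_colSet, image_insert, image_singleton]

lemma card_colSet_triple (d a b c : ℤ) :
    (#(colSet P (-d) {a, b, c}) : ℤ) = P.overlap {a + d * γ, b + d * γ, c + d * γ} := by
  simp only [card_colSet, image_insert, image_singleton]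

lemma card_colSet_quadruple (d a b c e : ℤ) : (#(colSet P (-d) {a, b, c, e}) : ℤ) =
    P.overlap {a + d * γ, b + d * γ, c + d * γ, e + d * γ} := by
  simp only [card_colSet, image_insert, image_singleton]

lemma colSet_inter_12_23 (r a b c : ℤ) :
    colSet P r {a, b} ∩ colSet P r {b, c} = colSet P r {a, b, c} := by
  rw [colSet_inter]; congr 1; grind

lemma colSet_inter_12_34 (r a b c e : ℤ) :
    colSet P r {a, b} ∩ colSet P r {c, e} = colSet P r {a, b, c, e} := by
  rw [colSet_inter]; congr 1; grind

lemma colSet_inter_12_14 (r a b e : ℤ) :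
    colSet P r {a, b} ∩ colSet P r {a, e} = colSet P r {a, b, e} := by
  rw [colSet_inter]; congr 1; grind

lemma colSet_inter_23_14 (r a b c e : ℤ) :
    colSet P r {b, c} ∩ colSet P r {a, e} = colSet P r {a, b, c, e} := by
  rw [colSet_inter]; congr 1; grind

lemma colSet_inter_34_14 (r a c e : ℤ) :
    colSet P r {c, e} ∩ colSet P r {a, e} = colSet P r {a, c, e} := by
  rw [colSet_inter]; congr 1; grind

lemma colSet_inter_123_34 (r a b c e : ℤ) :
    colSet P r {a, b, c} ∩ colSet P r {c, e} = colSet P r {a, b, c, e} := by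
  rw [colSet_inter]; congr 1; grind

lemma colSet_inter_123_14 (r a b c e : ℤ) :
    colSet P r {a, b, c} ∩ colSet P r {a, e} = colSet P r {a, b, c, e} := by
  rw [colSet_inter]; congr 1; grind

lemma colSet_inter_234_14 (r a b c e : ℤ) :
    colSet P r {b, c, e} ∩ colSet P r {a, e} = colSet P r {a, b, c, e} := by
  rw [colSet_inter]; congr 1; grind

lemma colSet_inter_1234_14 (r a b c e : ℤ) :
    colSet P r {a, b, c, e} ∩ colSet P r {a, e} = colSet P r {a, b, c, e} := by
  rw [colSet_inter]; congr 1; grind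

lemma cyclesAt_one_replica (h : Adm γ i₁ i₂ i₃ i₄) :
    (cyclesAt P ![0, 0, 0, 0] ![i₁, i₂, i₃, i₄] : ℤ) =
      fA (P.overlap {i₁, i₂}) (P.overlap {i₂, i₃}) (P.overlap {i₃, i₄}) (P.overlap {i₁, i₄})
        (P.overlap {i₁, i₂, i₃}) (P.overlap {i₁, i₂, i₄}) (P.overlap {i₁, i₃, i₄})
        (P.overlap {i₂, i₃, i₄}) (P.overlap {i₁, i₂, i₃, i₄}) := by
  have h0 := overlapIneqs_colSet P 0 i₁ i₂ i₃ i₄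
  simp only [← card_colSet_zero]
  rw [cyclesAt_eq P _ _ _ _ h, injQuadruples_eq_card, fA_eq h0]
  simp only [colSet_inter_12_23, colSet_inter_12_34 P _ i₁ i₂ i₃ i₄, colSet_inter_12_14,
    colSet_inter_23_14 P _ i₁ i₂ i₃ i₄,
    colSet_inter_34_14, colSet_inter_123_34, colSet_inter_123_14, colSet_inter_234_14,
    colSet_inter_1234_14]

/-- The last column lies in another replica, so every intersection with its set is empty and its
choice contributes an independent factor. The other mixed patterns factor for the same reason. -/
lemma cyclesAt_three_one (hd : d ≠ 0) (h : Adm γ i₁ i₂ i₃ i₄) :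
    (cyclesAt P ![0, 0, 0, -d] ![i₁, i₂, i₃, i₄] : ℤ) =
      fB (P.overlap {i₁, i₂}) (P.overlap {i₂, i₃}) (P.overlap {i₃, i₄}) (P.overlap {i₁, i₂, i₃})
        (P.overlap {i₂, i₃, i₄}) (P.overlap {i₁, i₂, i₃, i₄})
        (P.overlap {i₁ + d * γ, i₄ + d * γ}) := by
  have h0 := overlapIneqs_colSet P 0 i₁ i₂ i₃ i₄
  have hd0 : (0 : ℤ) ≠ -d := by omega
  simp only [← card_colSet_pair]
  simp only [← card_colSet_zero]
  rw [cyclesAt_eq P _ _ _ _ h, injQuadruples_eq_card, fB_eq h0]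
  simp only [colSet_inter_12_23, colSet_inter_12_34 P _ i₁ i₂ i₃ i₄, colSet_inter_123_34,
    colSet_inter_of_ne P hd0, card_empty]
  push_cast
  ring

lemma cyclesAt_two_two_adjacent (hd : d ≠ 0) (h : Adm γ i₁ i₂ i₃ i₄) :
    (cyclesAt P ![0, 0, -d, -d] ![i₁, i₂, i₃, i₄] : ℤ) =
      fC (P.overlap {i₁, i₂}) (P.overlap {i₂, i₃}) (P.overlap {i₁, i₂, i₃})
        (P.overlap {i₃ + d * γ, i₄ + d * γ}) (P.overlap {i₁ + d * γ, i₄ + d * γ})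
        (P.overlap {i₁ + d * γ, i₃ + d * γ, i₄ + d * γ}) := by
  have h0 := overlapIneqs_colSet P 0 i₁ i₂ i₃ i₄
  have h1 := overlapIneqs_colSet P (-d) i₁ i₂ i₃ i₄
  have hd0 : (0 : ℤ) ≠ -d := by omega
  simp only [← card_colSet_pair, ← card_colSet_triple]
  simp only [← card_colSet_zero]
  rw [cyclesAt_eq P _ _ _ _ h, injQuadruples_eq_card, fC_eq h0 h1]
  simp only [colSet_inter_12_23, colSet_inter_34_14, colSet_inter_of_ne P hd0, empty_inter,
    card_empty]
  push_cast
  ring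

lemma cyclesAt_two_two_opposite (hd : d ≠ 0) (h : Adm γ i₁ i₂ i₃ i₄) :
    (cyclesAt P ![0, -d, 0, -d] ![i₁, i₂, i₃, i₄] : ℤ) =
      fD (P.overlap {i₁, i₂}) (P.overlap {i₃, i₄}) (P.overlap {i₁, i₂, i₃, i₄})
        (P.overlap {i₂ + d * γ, i₃ + d * γ}) (P.overlap {i₁ + d * γ, i₄ + d * γ})
        (P.overlap {i₁ + d * γ, i₂ + d * γ, i₃ + d * γ, i₄ + d * γ}) := by
  have h0 := overlapIneqs_colSet P 0 i₁ i₂ i₃ i₄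
  have h1 := overlapIneqs_colSet P (-d) i₁ i₂ i₃ i₄
  have hd0 : (0 : ℤ) ≠ -d := by omega
  simp only [← card_colSet_pair, ← card_colSet_quadruple]
  simp only [← card_colSet_zero]
  rw [cyclesAt_eq P _ _ _ _ h, injQuadruples_eq_card, fD_eq h0 h1]
  simp only [colSet_inter_12_34 P _ i₁ i₂ i₃ i₄, colSet_inter_23_14 P _ i₁ i₂ i₃ i₄,
    colSet_inter_of_ne P hd0,
    colSet_inter_of_ne P hd0.symm, empty_inter, card_empty]
  push_cast
  ring

lemma cyclesAt_two_adjacent (hd : d ≠ 0) (hd' : d' ≠ 0) (hdd' : d ≠ d')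
    (h : Adm γ i₁ i₂ i₃ i₄) :
    (cyclesAt P ![0, 0, -d, -d'] ![i₁, i₂, i₃, i₄] : ℤ) =
      fE (P.overlap {i₁, i₂}) (P.overlap {i₂, i₃}) (P.overlap {i₁, i₂, i₃})
        (P.overlap {i₃ + d * γ, i₄ + d * γ}) (P.overlap {i₁ + d' * γ, i₄ + d' * γ}) := by
  have h0 := overlapIneqs_colSet P 0 i₁ i₂ i₃ i₄
  have hd0 : (0 : ℤ) ≠ -d := by omega
  have hd1 : (0 : ℤ) ≠ -d' := by omega
  have hd2 : -d ≠ -d' := by omega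
  simp only [← card_colSet_pair]
  simp only [← card_colSet_zero]
  rw [cyclesAt_eq P _ _ _ _ h, injQuadruples_eq_card, fE_eq h0]
  simp only [colSet_inter_12_23, colSet_inter_of_ne P hd0, colSet_inter_of_ne P hd1,
    colSet_inter_of_ne P hd2, empty_inter, card_empty]
  push_cast
  ring

lemma cyclesAt_two_opposite (hd : d ≠ 0) (hd' : d' ≠ 0) (hdd' : d ≠ d')
    (h : Adm γ i₁ i₂ i₃ i₄) :
    (cyclesAt P ![0, -d, 0, -d'] ![i₁, i₂, i₃, i₄] : ℤ) =
      fG (P.overlap {i₁, i₂}) (P.overlap {i₃, i₄}) (P.overlap {i₁, i₂, i₃, i₄})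
        (P.overlap {i₂ + d * γ, i₃ + d * γ}) (P.overlap {i₁ + d' * γ, i₄ + d' * γ}) := by
  have h0 := overlapIneqs_colSet P 0 i₁ i₂ i₃ i₄
  have hd0 : (0 : ℤ) ≠ -d := by omega
  have hd1 : (0 : ℤ) ≠ -d' := by omega
  have hd2 : -d ≠ -d' := by omega
  simp only [← card_colSet_pair]
  simp only [← card_colSet_zero]
  rw [cyclesAt_eq P _ _ _ _ h, injQuadruples_eq_card, fG_eq h0]
  simp only [colSet_inter_12_34 P _ i₁ i₂ i₃ i₄, colSet_inter_of_ne P hd0,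
    colSet_inter_of_ne P hd0.symm,
    colSet_inter_of_ne P hd1, colSet_inter_of_ne P hd2, empty_inter, card_empty]
  push_cast
  ring

lemma cyclesAt_four_replicas (hd : d ≠ 0) (hd' : d' ≠ 0) (hd'' : d'' ≠ 0) (h12 : d ≠ d')
    (h13 : d ≠ d'') (h23 : d' ≠ d'') (h : Adm γ i₁ i₂ i₃ i₄) :
    (cyclesAt P ![0, -d, -d', -d''] ![i₁, i₂, i₃, i₄] : ℤ) =
      fI (P.overlap {i₁, i₂}) (P.overlap {i₂ + d * γ, i₃ + d * γ})
        (P.overlap {i₃ + d' * γ, i₄ + d' * γ}) (P.overlap {i₁ + d'' * γ, i₄ + d'' * γ}) := by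
  have hd0 : (0 : ℤ) ≠ -d := by omega
  have hd1 : (0 : ℤ) ≠ -d' := by omega
  have hd2 : (0 : ℤ) ≠ -d'' := by omega
  have hd3 : -d ≠ -d' := by omega
  have hd4 : -d ≠ -d'' := by omega
  have hd5 : -d' ≠ -d'' := by omega
  simp only [← card_colSet_pair]
  simp only [← card_colSet_zero]
  rw [cyclesAt_eq P _ _ _ _ h, injQuadruples_eq_card, fI]
  simp only [colSet_inter_of_ne P hd0, colSet_inter_of_ne P hd1, colSet_inter_of_ne P hd2,
    colSet_inter_of_ne P hd3, colSet_inter_of_ne P hd4, colSet_inter_of_ne P hd5, empty_inter,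
    card_empty]
  push_cast
  ring

end CyclesAtValues

/-! ### From ordered rows to unordered pairs. -/

section Summations

lemma adm_swap14_swap23 {i₁ i₂ i₃ i₄ : ℤ} : Adm γ i₄ i₃ i₂ i₁ ↔ Adm γ i₁ i₂ i₃ i₄ :=
  ⟨fun ⟨h1, h2, h3, h4, h5, h6⟩ => ⟨h6.symm, h5.symm, h3.symm, h4.symm, h2.symm, h1.symm⟩,
    fun ⟨h1, h2, h3, h4, h5, h6⟩ => ⟨h6.symm, h5.symm, h3.symm, h4.symm, h2.symm, h1.symm⟩⟩

lemma adm_swap13 {i₁ i₂ i₃ i₄ : ℤ} : Adm γ i₃ i₂ i₁ i₄ ↔ Adm γ i₁ i₂ i₃ i₄ :=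
  ⟨fun ⟨h1, h2, h3, h4, h5, h6⟩ => ⟨h4.symm, h2.symm, h6, h1.symm, h5, h3⟩,
    fun ⟨h1, h2, h3, h4, h5, h6⟩ => ⟨h4.symm, h2.symm, h6, h1.symm, h5, h3⟩⟩

lemma adm_swap24 {i₁ i₂ i₃ i₄ : ℤ} : Adm γ i₁ i₄ i₃ i₂ ↔ Adm γ i₁ i₂ i₃ i₄ :=
  ⟨fun ⟨h1, h2, h3, h4, h5, h6⟩ => ⟨h3, h2, h1, h6.symm, h5.symm, h4.symm⟩,
    fun ⟨h1, h2, h3, h4, h5, h6⟩ => ⟨h3, h2, h1, h6.symm, h5.symm, h4.symm⟩⟩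

variable {F G : ℤ → ℤ → ℤ → ℤ → ℤ}

lemma sumAll_congr (h : ∀ {i₁ i₂ i₃ i₄}, Adm γ i₁ i₂ i₃ i₄ → F i₁ i₂ i₃ i₄ = G i₁ i₂ i₃ i₄)
    (S₁ S₂ S₃ S₄ : Finset ℤ) : sumAll γ S₁ S₂ S₃ S₄ F = sumAll γ S₁ S₂ S₃ S₄ G := by
  unfold sumAll
  refine sum_congr rfl fun i₁ _ => sum_congr rfl fun i₂ _ => sum_congr rfl fun i₃ _ =>
    sum_congr rfl fun i₄ _ => ?_
  split_ifs with hi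
  exacts [h hi, rfl]

lemma sumPair13_congr (h : ∀ {i₁ i₂ i₃ i₄}, Adm γ i₁ i₂ i₃ i₄ → F i₁ i₂ i₃ i₄ = G i₁ i₂ i₃ i₄)
    (S S₂ S₄ : Finset ℤ) : sumPair13 γ S S₂ S₄ F = sumPair13 γ S S₂ S₄ G := by
  unfold sumPair13
  refine sum_congr rfl fun i₁ _ => sum_congr rfl fun i₃ _ => sum_congr rfl fun i₂ _ =>
    sum_congr rfl fun i₄ _ => ?_
  split_ifs with hi
  exacts [h hi, rfl]

lemma sumPair14_congr (h : ∀ {i₁ i₂ i₃ i₄}, Adm γ i₁ i₂ i₃ i₄ → F i₁ i₂ i₃ i₄ = G i₁ i₂ i₃ i₄)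
    (S S₂ S₃ : Finset ℤ) : sumPair14 γ S S₂ S₃ F = sumPair14 γ S S₂ S₃ G := by
  unfold sumPair14
  refine sum_congr rfl fun i₁ _ => sum_congr rfl fun i₄ _ => sum_congr rfl fun i₂ _ =>
    sum_congr rfl fun i₃ _ => ?_
  split_ifs with hi
  exacts [h hi, rfl]

lemma sumPair13Pair24_congr
    (h : ∀ {i₁ i₂ i₃ i₄}, Adm γ i₁ i₂ i₃ i₄ → F i₁ i₂ i₃ i₄ = G i₁ i₂ i₃ i₄)
    (S T : Finset ℤ) : sumPair13Pair24 γ S T F = sumPair13Pair24 γ S T G := by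
  unfold sumPair13Pair24
  refine sum_congr rfl fun i₁ _ => sum_congr rfl fun i₃ _ => sum_congr rfl fun i₂ _ =>
    sum_congr rfl fun i₄ _ => ?_
  split_ifs with hi
  exacts [h hi, rfl]

lemma sum_sum_eq_two_mul {A : Finset ℤ} {g : ℤ → ℤ → ℤ} (hg : ∀ a b, g b a = g a b)
    (hg0 : ∀ a, g a a = 0) :
    ∑ a ∈ A, ∑ b ∈ A, g a b = 2 * ∑ a ∈ A, ∑ b ∈ A with a < b, g a b := by
  rw [sum_sum_eq_diag_add]
  simp only [hg0, sum_const_zero, zero_add, hg, ← two_mul, ← mul_sum]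

/-- The reflection exchanging 1 with 4 and 2 with 3 preserves the summand and the ranges. It has no
fixed points because admissibility excludes `i₁ = i₄`. -/
lemma sumAll_eq_sumPair14 (hF : ∀ i₁ i₂ i₃ i₄, F i₄ i₃ i₂ i₁ = F i₁ i₂ i₃ i₄) (S T : Finset ℤ) :
    sumAll γ S T T S F = 2 * sumPair14 γ S T T F := by
  have h : sumAll γ S T T S F = ∑ i₁ ∈ S, ∑ i₄ ∈ S, ∑ i₂ ∈ T, ∑ i₃ ∈ T,
      if Adm γ i₁ i₂ i₃ i₄ then F i₁ i₂ i₃ i₄ else 0 := by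
    unfold sumAll
    refine sum_congr rfl fun i₁ _ => ?_
    rw [sum_comm]
    exact (sum_congr rfl fun i₂ _ => sum_comm).trans (sum_comm.trans
      (sum_congr rfl fun i₄ _ => sum_comm))
  rw [h, sumPair14, sum_sum_eq_two_mul]
  · intro i₁ i₄
    rw [sum_comm]
    simp only [adm_swap14_swap23, hF]
  · intro i
    refine sum_eq_zero fun i₂ _ => sum_eq_zero fun i₃ _ => if_neg fun h => ?_
    exact h.2.2.1 rfl

lemma sumAll_eq_sumPair13 (hF : ∀ i₁ i₂ i₃ i₄, F i₃ i₂ i₁ i₄ = F i₁ i₂ i₃ i₄)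
    (S S₂ S₄ : Finset ℤ) : sumAll γ S S₂ S S₄ F = 2 * sumPair13 γ S S₂ S₄ F := by
  have h : sumAll γ S S₂ S S₄ F = ∑ i₁ ∈ S, ∑ i₃ ∈ S, ∑ i₂ ∈ S₂, ∑ i₄ ∈ S₄,
      if Adm γ i₁ i₂ i₃ i₄ then F i₁ i₂ i₃ i₄ else 0 :=
    sum_congr rfl fun i₁ _ => sum_comm
  rw [h, sumPair13, sum_sum_eq_two_mul]
  · intro i₁ i₃
    simp only [adm_swap13, hF]
  · intro i
    refine sum_eq_zero fun i₂ _ => sum_eq_zero fun i₃ _ => if_neg fun h => ?_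
    exact h.2.1 rfl

lemma sumAll_eq_sumPair13Pair24 (hF : ∀ i₁ i₂ i₃ i₄, F i₃ i₂ i₁ i₄ = F i₁ i₂ i₃ i₄)
    (hF' : ∀ i₁ i₂ i₃ i₄, F i₁ i₄ i₃ i₂ = F i₁ i₂ i₃ i₄) (S T : Finset ℤ) :
    sumAll γ S T S T F = 4 * sumPair13Pair24 γ S T F := by
  have h : ∀ i₁ i₃, ∑ i₂ ∈ T, ∑ i₄ ∈ T, (if Adm γ i₁ i₂ i₃ i₄ then F i₁ i₂ i₃ i₄ else 0) =
      2 * ∑ i₂ ∈ T, ∑ i₄ ∈ T with i₂ < i₄,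
        if Adm γ i₁ i₂ i₃ i₄ then F i₁ i₂ i₃ i₄ else 0 := by
    intro i₁ i₃
    refine sum_sum_eq_two_mul (fun i₂ i₄ => ?_) fun i => if_neg fun h => h.2.2.2.2.1 rfl
    simp only [adm_swap24, hF']
  rw [sumAll_eq_sumPair13 hF, sumPair13, sumPair13Pair24]
  simp only [h, ← mul_sum]
  ring

end Summations

/-! ### Summing over the rows and assembling the formulas. -/

section ClosedFormulas

variable (P : Partitioning γ κ m) {d d' d'' a₁ a₂ a₃ a₄ b₁ b₂ b₃ b₄ : ℤ}

lemma numCycles_one_replica : (numCycles P ![0, 0, 0, 0] : ℤ) =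
    4 * sumPair13Pair24 γ (rng γ 0 (m + 1)) (rng γ 0 (m + 1)) fun i₁ i₂ i₃ i₄ =>
      fA (P.overlap {i₁, i₂}) (P.overlap {i₂, i₃}) (P.overlap {i₃, i₄}) (P.overlap {i₁, i₄})
        (P.overlap {i₁, i₂, i₃}) (P.overlap {i₁, i₂, i₄}) (P.overlap {i₁, i₃, i₄})
        (P.overlap {i₂, i₃, i₄}) (P.overlap {i₁, i₂, i₃, i₄}) := by
  rw [numCycles_eq_sumAll P (a₁ := 0) (a₂ := 0) (a₃ := 0) (a₄ := 0) (b₁ := m + 1) (b₂ := m + 1)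
    (b₃ := m + 1) (b₄ := m + 1) (by simp) (by simp) (by simp) (by simp) (by simp) (by simp)
    (by simp) (by simp), sumAll_eq_sumPair13Pair24]
  · rw [sumPair13Pair24_congr fun h => cyclesAt_one_replica P h]
  · intro i₁ i₂ i₃ i₄
    rw [cyclesAt_swap13]
  · intro i₁ i₂ i₃ i₄
    rw [cyclesAt_swap24]

lemma numCycles_three_one (hd : d ≠ 0) (ha : a₁ ≤ 0 ∨ a₁ ≤ -d)
    (hb : (m : ℤ) + 1 ≤ b₁ ∨ -d + m + 1 ≤ b₁) : (numCycles P ![0, 0, 0, -d] : ℤ) =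
    2 * sumPair14 γ (rng γ a₁ b₁) (rng γ 0 (m + 1)) (rng γ 0 (m + 1)) fun i₁ i₂ i₃ i₄ =>
      fB (P.overlap {i₁, i₂}) (P.overlap {i₂, i₃}) (P.overlap {i₃, i₄}) (P.overlap {i₁, i₂, i₃})
        (P.overlap {i₂, i₃, i₄}) (P.overlap {i₁, i₂, i₃, i₄})
        (P.overlap {i₁ + d * γ, i₄ + d * γ}) := by
  rw [numCycles_eq_sumAll P (a₁ := a₁) (a₂ := 0) (a₃ := 0) (a₄ := a₁) (b₁ := b₁) (b₂ := m + 1)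
    (b₃ := m + 1) (b₄ := b₁) ha (by simp) (by simp) ha (by omega) (by simp) (by simp) (by omega),
    sumAll_eq_sumPair14]
  · rw [sumPair14_congr fun h => cyclesAt_three_one P hd h]
  · intro i₁ i₂ i₃ i₄
    rw [cyclesAt_swap14_swap23]

/-- Rows 1 and 3 each meet both replicas, so they share a range and can be exchanged. Row 4 meets
only replica `-d`, hence its bounds offer no alternative. -/
lemma numCycles_two_two_adjacent (hd : d ≠ 0) (ha₁ : a₁ ≤ 0 ∨ a₁ ≤ -d) (ha₄ : a₄ ≤ -d)
    (hb₁ : (m : ℤ) + 1 ≤ b₁ ∨ -d + m + 1 ≤ b₁) (hb₄ : -d + m + 1 ≤ b₄) :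
    (numCycles P ![0, 0, -d, -d] : ℤ) =
    2 * sumPair13 γ (rng γ a₁ b₁) (rng γ 0 (m + 1)) (rng γ a₄ b₄) fun i₁ i₂ i₃ i₄ =>
      fC (P.overlap {i₁, i₂}) (P.overlap {i₂, i₃}) (P.overlap {i₁, i₂, i₃})
        (P.overlap {i₃ + d * γ, i₄ + d * γ}) (P.overlap {i₁ + d * γ, i₄ + d * γ})
        (P.overlap {i₁ + d * γ, i₃ + d * γ, i₄ + d * γ}) := by
  rw [numCycles_eq_sumAll P (a₁ := a₁) (a₂ := 0) (a₃ := a₁) (a₄ := a₄) (b₁ := b₁) (b₂ := m + 1)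
    (b₃ := b₁) (b₄ := b₄) ha₁ (by simp) ha₁ (by simp [ha₄]) (by omega) (by simp) (by omega)
    (by simp [hb₄]), sumAll_eq_sumPair13]
  · rw [sumPair13_congr fun h => cyclesAt_two_two_adjacent P hd h]
  · intro i₁ i₂ i₃ i₄
    rw [cyclesAt_swap13]

lemma numCycles_two_two_opposite (hd : d ≠ 0) (ha : a₁ ≤ 0 ∨ a₁ ≤ -d)
    (hb : (m : ℤ) + 1 ≤ b₁ ∨ -d + m + 1 ≤ b₁) : (numCycles P ![0, -d, 0, -d] : ℤ) =
    2 * sumPair14 γ (rng γ a₁ b₁) (rng γ a₁ b₁) (rng γ a₁ b₁) fun i₁ i₂ i₃ i₄ =>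
      fD (P.overlap {i₁, i₂}) (P.overlap {i₃, i₄}) (P.overlap {i₁, i₂, i₃, i₄})
        (P.overlap {i₂ + d * γ, i₃ + d * γ}) (P.overlap {i₁ + d * γ, i₄ + d * γ})
        (P.overlap {i₁ + d * γ, i₂ + d * γ, i₃ + d * γ, i₄ + d * γ}) := by
  rw [numCycles_eq_sumAll P (a₁ := a₁) (a₂ := a₁) (a₃ := a₁) (a₄ := a₁) (b₁ := b₁) (b₂ := b₁)
    (b₃ := b₁) (b₄ := b₁) (by omega) (by omega) (by omega) (by omega) (by omega) (by omega)
    (by omega) (by omega), sumAll_eq_sumPair14]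
  · rw [sumPair14_congr fun h => cyclesAt_two_two_opposite P hd h]
  · intro i₁ i₂ i₃ i₄
    rw [cyclesAt_swap14_swap23]

lemma numCycles_two_adjacent (hd : d ≠ 0) (hd' : d' ≠ 0) (hdd' : d ≠ d')
    (ha₁ : a₁ ≤ 0 ∨ a₁ ≤ -d') (ha₃ : a₃ ≤ 0 ∨ a₃ ≤ -d) (ha₄ : a₄ ≤ -d ∨ a₄ ≤ -d')
    (hb₁ : (m : ℤ) + 1 ≤ b₁ ∨ -d' + m + 1 ≤ b₁) (hb₃ : (m : ℤ) + 1 ≤ b₃ ∨ -d + m + 1 ≤ b₃)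
    (hb₄ : -d + m + 1 ≤ b₄ ∨ -d' + m + 1 ≤ b₄) : (numCycles P ![0, 0, -d, -d'] : ℤ) =
    sumAll γ (rng γ a₁ b₁) (rng γ 0 (m + 1)) (rng γ a₃ b₃) (rng γ a₄ b₄) fun i₁ i₂ i₃ i₄ =>
      fE (P.overlap {i₁, i₂}) (P.overlap {i₂, i₃}) (P.overlap {i₁, i₂, i₃})
        (P.overlap {i₃ + d * γ, i₄ + d * γ}) (P.overlap {i₁ + d' * γ, i₄ + d' * γ}) := by
  rw [numCycles_eq_sumAll P (a₁ := a₁) (a₂ := 0) (a₃ := a₃) (a₄ := a₄) (b₁ := b₁) (b₂ := m + 1)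
    (b₃ := b₃) (b₄ := b₄) ha₁ (by simp) ha₃ ha₄ (by omega) (by simp) (by omega) hb₄,
    sumAll_congr fun h => cyclesAt_two_adjacent P hd hd' hdd' h]

lemma numCycles_two_opposite (hd : d ≠ 0) (hd' : d' ≠ 0) (hdd' : d ≠ d')
    (ha₁ : a₁ ≤ 0 ∨ a₁ ≤ -d') (ha₂ : a₂ ≤ 0 ∨ a₂ ≤ -d)
    (hb₁ : (m : ℤ) + 1 ≤ b₁ ∨ -d' + m + 1 ≤ b₁) (hb₂ : (m : ℤ) + 1 ≤ b₂ ∨ -d + m + 1 ≤ b₂) :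
    (numCycles P ![0, -d, 0, -d'] : ℤ) =
    2 * sumPair14 γ (rng γ a₁ b₁) (rng γ a₂ b₂) (rng γ a₂ b₂) fun i₁ i₂ i₃ i₄ =>
      fG (P.overlap {i₁, i₂}) (P.overlap {i₃, i₄}) (P.overlap {i₁, i₂, i₃, i₄})
        (P.overlap {i₂ + d * γ, i₃ + d * γ}) (P.overlap {i₁ + d' * γ, i₄ + d' * γ}) := by
  rw [numCycles_eq_sumAll P (a₁ := a₁) (a₂ := a₂) (a₃ := a₂) (a₄ := a₁) (b₁ := b₁) (b₂ := b₂)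
    (b₃ := b₂) (b₄ := b₁) (by omega) (by omega) (by omega) (by omega) (by omega) (by omega)
    (by omega) (by omega), sumAll_eq_sumPair14]
  · rw [sumPair14_congr fun h => cyclesAt_two_opposite P hd hd' hdd' h]
  · intro i₁ i₂ i₃ i₄
    rw [cyclesAt_swap14_swap23]

lemma numCycles_four_replicas (hd : d ≠ 0) (hd' : d' ≠ 0) (hd'' : d'' ≠ 0) (h12 : d ≠ d')
    (h13 : d ≠ d'') (h23 : d' ≠ d'')
    (ha₁ : a₁ ≤ 0 ∨ a₁ ≤ -d'') (ha₂ : a₂ ≤ 0 ∨ a₂ ≤ -d) (ha₃ : a₃ ≤ -d ∨ a₃ ≤ -d')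
    (ha₄ : a₄ ≤ -d' ∨ a₄ ≤ -d'') (hb₁ : (m : ℤ) + 1 ≤ b₁ ∨ -d'' + m + 1 ≤ b₁)
    (hb₂ : (m : ℤ) + 1 ≤ b₂ ∨ -d + m + 1 ≤ b₂) (hb₃ : -d + m + 1 ≤ b₃ ∨ -d' + m + 1 ≤ b₃)
    (hb₄ : -d' + m + 1 ≤ b₄ ∨ -d'' + m + 1 ≤ b₄) : (numCycles P ![0, -d, -d', -d''] : ℤ) =
    sumAll γ (rng γ a₁ b₁) (rng γ a₂ b₂) (rng γ a₃ b₃) (rng γ a₄ b₄) fun i₁ i₂ i₃ i₄ =>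
      fI (P.overlap {i₁, i₂}) (P.overlap {i₂ + d * γ, i₃ + d * γ})
        (P.overlap {i₃ + d' * γ, i₄ + d' * γ}) (P.overlap {i₁ + d'' * γ, i₄ + d'' * γ}) := by
  rw [numCycles_eq_sumAll P (a₁ := a₁) (a₂ := a₂) (a₃ := a₃) (a₄ := a₄) (b₁ := b₁) (b₂ := b₂)
    (b₃ := b₃) (b₄ := b₄) ha₁ ha₂ ha₃ ha₄ (by omega) (by omega) hb₃ hb₄,
    sumAll_congr fun h => cyclesAt_four_replicas P hd hd' hd'' h12 h13 h23 h]

/-- Translation brings the replica of the `c₁`-`c₂` overlap to `0`, the normalisation in which the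
formulas leave `t12` unshifted. -/
lemma numCycles_shift (s a b c e : ℤ) {a' b' c' e' : ℤ} (ha : a + s = a') (hb : b + s = b')
    (hc : c + s = c') (he : e + s = e') :
    (numCycles P ![a', b', c', e'] : ℤ) = numCycles P ![a, b, c, e] := by
  rw [← numCycles_add P ![a, b, c, e] s]
  congr 2
  ext x
  fin_cases x
  exacts [ha.symm, hb.symm, hc.symm, he.symm]

/-- The number of ordered cycles with columns in given replicas. -/
noncomputable def cyclesIn (a b c e : ℤ) : ℤ := numCycles P ![a, b, c, e]

/-- The orbit sizes are 4, 4, 4 and 2, and each count is twice a sum over unordered pairs. The first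
three coefficients are thus 8/8, and that of `fD` is 4/8 = 1/2. -/
lemma eight_mul_formulaTwo {k : ℤ} (hk : 2 ≤ k) : 8 * formulaTwo γ m P.overlap k =
    ((4 * (cyclesIn P 0 0 0 (k - 1) + cyclesIn P (k - 1) (k - 1) (k - 1) 0
      + cyclesIn P 0 0 (k - 1) (k - 1)) + 2 * cyclesIn P 0 (k - 1) 0 (k - 1) : ℤ) : ℚ) := by
  have e1 := (numCycles_shift P 0 0 0 0 (-(1 - k)) (a' := 0) (b' := 0) (c' := 0) (e' := k - 1)
    (by ring) (by ring) (by ring) (by ring)).trans (numCycles_three_one P (d := 1 - k)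
      (a₁ := k - 1) (b₁ := m + 1) (by omega) (by omega) (by omega))
  have e2 := (numCycles_shift P (k - 1) 0 0 0 (-(k - 1)) (a' := k - 1) (b' := k - 1) (c' := k - 1)
    (e' := 0) (by ring) (by ring) (by ring) (by ring)).trans (numCycles_three_one P (d := k - 1)
      (a₁ := 0) (b₁ := m - k + 2) (by omega) (by omega) (by omega))
  have e3 := (numCycles_shift P 0 0 0 (-(1 - k)) (-(1 - k)) (a' := 0) (b' := 0) (c' := k - 1)
    (e' := k - 1) (by ring) (by ring) (by ring) (by ring)).trans (numCycles_two_two_adjacent P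
      (d := 1 - k) (a₁ := k - 1) (b₁ := m + 1) (a₄ := k - 1) (b₄ := m + k)
      (by omega) (by omega) (by omega) (by omega) (by omega))
  have e4 := (numCycles_shift P 0 0 (-(1 - k)) 0 (-(1 - k)) (a' := 0) (b' := k - 1) (c' := 0)
    (e' := k - 1) (by ring) (by ring) (by ring) (by ring)).trans (numCycles_two_two_opposite P
      (d := 1 - k) (a₁ := k - 1) (b₁ := m + 1) (by omega) (by omega) (by omega))
  unfold cyclesIn formulaTwo
  rw [e1, e2, e3, e4]
  push_cast
  ring

/-- The patterns of `fE` have no symmetry and orbits of size 8; those of `fG` have one reflection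
and orbits of size 4, compensated by the factor 2 of the pairs. -/
lemma eight_mul_formulaThree {k h : ℤ} (hh : 2 ≤ h) (hk : h + 1 ≤ k) :
    8 * formulaThree γ m P.overlap k h =
    ((8 * (cyclesIn P 0 0 (h - 1) (k - 1) + cyclesIn P (h - 1) (h - 1) 0 (k - 1)
        + cyclesIn P (k - 1) (k - 1) 0 (h - 1))
      + 4 * (cyclesIn P 0 (h - 1) 0 (k - 1) + cyclesIn P (h - 1) 0 (h - 1) (k - 1)
        + cyclesIn P (k - 1) 0 (k - 1) (h - 1)) : ℤ) : ℚ) := by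
  have e1 := (numCycles_shift P 0 0 0 (-(1 - h)) (-(1 - k)) (a' := 0) (b' := 0) (c' := h - 1)
    (e' := k - 1) (by ring) (by ring) (by ring) (by ring)).trans (numCycles_two_adjacent P
      (d := 1 - h) (d' := 1 - k) (a₁ := k - 1) (b₁ := m + 1) (a₃ := h - 1) (b₃ := m + 1)
      (a₄ := k - 1) (b₄ := m + h) (by omega) (by omega) (by omega) (by omega) (by omega) (by omega)
      (by omega) (by omega) (by omega))
  have e2 := (numCycles_shift P (h - 1) 0 0 (-(h - 1)) (-(h - k)) (a' := h - 1) (b' := h - 1)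
    (c' := 0) (e' := k - 1) (by ring) (by ring) (by ring) (by ring)).trans
      (numCycles_two_adjacent P (d := h - 1) (d' := h - k) (a₁ := k - h) (b₁ := m + 1) (a₃ := 0)
      (b₃ := m - h + 2) (a₄ := k - h) (b₄ := m - h + 2) (by omega) (by omega) (by omega) (by omega)
      (by omega) (by omega) (by omega) (by omega) (by omega))
  have e3 := (numCycles_shift P (k - 1) 0 0 (-(k - 1)) (-(k - h)) (a' := k - 1) (b' := k - 1)
    (c' := 0) (e' := h - 1) (by ring) (by ring) (by ring) (by ring)).trans
      (numCycles_two_adjacent P (d := k - 1) (d' := k - h) (a₁ := 0) (b₁ := m - k + h + 1)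
      (a₃ := 0) (b₃ := m - k + 2) (a₄ := h - k) (b₄ := m - k + 2) (by omega) (by omega) (by omega)
      (by omega) (by omega) (by omega) (by omega) (by omega) (by omega))
  have e4 := (numCycles_shift P 0 0 (-(1 - h)) 0 (-(1 - k)) (a' := 0) (b' := h - 1) (c' := 0)
    (e' := k - 1) (by ring) (by ring) (by ring) (by ring)).trans (numCycles_two_opposite P
      (d := 1 - h) (d' := 1 - k) (a₁ := k - 1) (b₁ := m + 1) (a₂ := h - 1) (b₂ := m + 1)
      (by omega) (by omega) (by omega) (by omega) (by omega) (by omega) (by omega))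
  have e5 := (numCycles_shift P (h - 1) 0 (-(h - 1)) 0 (-(h - k)) (a' := h - 1) (b' := 0)
    (c' := h - 1) (e' := k - 1) (by ring) (by ring) (by ring) (by ring)).trans
      (numCycles_two_opposite P (d := h - 1) (d' := h - k) (a₁ := k - h) (b₁ := m + 1) (a₂ := 0)
      (b₂ := m - h + 2) (by omega) (by omega) (by omega) (by omega) (by omega) (by omega)
      (by omega))
  have e6 := (numCycles_shift P (k - 1) 0 (-(k - 1)) 0 (-(k - h)) (a' := k - 1) (b' := 0)
    (c' := k - 1) (e' := h - 1) (by ring) (by ring) (by ring) (by ring)).trans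
      (numCycles_two_opposite P (d := k - 1) (d' := k - h) (a₁ := 0) (b₁ := m - k + h + 1)
      (a₂ := 0) (b₂ := m - k + 2) (by omega) (by omega) (by omega) (by omega) (by omega) (by omega)
      (by omega))
  unfold cyclesIn formulaThree
  rw [e1, e2, e3, e4, e5, e6]
  push_cast
  ring

lemma eight_mul_formulaFour {k h w : ℤ} (hh : 2 ≤ h) (hw : h + 1 ≤ w) (hk : w + 1 ≤ k) :
    8 * formulaFour γ m P.overlap k h w =
    ((8 * (cyclesIn P 0 (h - 1) (w - 1) (k - 1) + cyclesIn P 0 (w - 1) (h - 1) (k - 1)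
      + cyclesIn P 0 (h - 1) (k - 1) (w - 1)) : ℤ) : ℚ) := by
  have e1 := (numCycles_shift P 0 0 (-(1 - h)) (-(1 - w)) (-(1 - k)) (a' := 0) (b' := h - 1)
    (c' := w - 1) (e' := k - 1) (by ring) (by ring) (by ring) (by ring)).trans
      (numCycles_four_replicas P (a₁ := k - 1) (b₁ := m + 1) (a₂ := h - 1) (b₂ := m + 1)
      (a₃ := w - 1) (b₃ := m + h) (a₄ := k - 1) (b₄ := m + w) (by omega) (by omega) (by omega)
      (by omega) (by omega) (by omega) (by omega) (by omega) (by omega) (by omega) (by omega)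
      (by omega) (by omega) (by omega))
  have e2 := (numCycles_shift P 0 0 (-(1 - w)) (-(1 - h)) (-(1 - k)) (a' := 0) (b' := w - 1)
    (c' := h - 1) (e' := k - 1) (by ring) (by ring) (by ring) (by ring)).trans
      (numCycles_four_replicas P (a₁ := k - 1) (b₁ := m + 1) (a₂ := w - 1) (b₂ := m + 1)
      (a₃ := w - 1) (b₃ := m + h) (a₄ := k - 1) (b₄ := m + h) (by omega) (by omega) (by omega)
      (by omega) (by omega) (by omega) (by omega) (by omega) (by omega) (by omega) (by omega)
      (by omega) (by omega) (by omega))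
  have e3 := (numCycles_shift P 0 0 (-(1 - h)) (-(1 - k)) (-(1 - w)) (a' := 0) (b' := h - 1)
    (c' := k - 1) (e' := w - 1) (by ring) (by ring) (by ring) (by ring)).trans
      (numCycles_four_replicas P (a₁ := w - 1) (b₁ := m + 1) (a₂ := h - 1) (b₂ := m + 1)
      (a₃ := k - 1) (b₃ := m + h) (a₄ := k - 1) (b₄ := m + w) (by omega) (by omega) (by omega)
      (by omega) (by omega) (by omega) (by omega) (by omega) (by omega) (by omega) (by omega)
      (by omega) (by omega) (by omega))
  unfold cyclesIn formulaFour
  rw [e1, e2, e3]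
  push_cast
  ring

lemma numP9Span_eq_formula {L k : ℕ} (hk : 1 ≤ k) (hkL : k ≤ L) :
    (P.numP9Span L k : ℚ) = formula γ m P.overlap k := by
  have h8 : (8 : ℚ) ≠ 0 := by norm_num
  apply mul_left_cancel₀ h8
  have hspan : (8 * P.numP9Span L k : ℚ) = (spanSum (fun r => numCycles P r) k : ℤ) := by
    rw [← eight_mul_numP9Span P hkL]
    push_cast
    ring
  rw [hspan, formula]
  rcases hk.eq_or_lt with rfl | hk
  -- With all columns in one replica there is a single quadruple, and the two row exchanges give the
  -- factor 4 = 8 · 1/2.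
  · rw [spanSum_one, numCycles_one_replica, if_pos (by norm_num), formulaOne]
    push_cast
    ring
  · rw [spanSum_eq (f := cyclesIn P) (fun a b c d => rfl)
      (fun a b c d => by
        unfold cyclesIn
        rw [← numCycles_rot P ![a, b, c, d], comp_rot])
      (fun a b c d => by
        unfold cyclesIn
        rw [← numCycles_refl P ![a, b, c, d], comp_reflCol]) hk,
      if_neg (by norm_cast; omega), mul_add (8 : ℚ), mul_add (8 : ℚ),
      eight_mul_formulaTwo P (k := k) (by omega),
      Int.cast_add, Int.cast_add]
    congr 1
    · congr 1
      rw [Int.cast_sum, mul_sum]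
      -- Replicas are numbered from 0 in `spanSum` but from 1 in the formula.
      refine sum_nbij' (fun h => h + 1) (fun h => h - 1) ?_ ?_ ?_ ?_ ?_
      · intro h hh; rw [mem_Ico] at hh; rw [mem_Icc]; omega
      · intro h hh; rw [mem_Icc] at hh; rw [mem_Ico]; omega
      · intro h _; ring
      · intro h _; ring
      · intro h hh
        rw [mem_Ico] at hh
        rw [eight_mul_formulaThree P (by omega) (by omega), add_sub_cancel_right]
    · rw [Int.cast_sum, mul_sum]
      simp only [Int.cast_sum, mul_sum]
      rw [sum_sigma', sum_sigma']
      refine sum_nbij' (fun p => ⟨p.1 + 1, p.2 + 1⟩) (fun p => ⟨p.1 - 1, p.2 - 1⟩) ?_ ?_ ?_ ?_ ?_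
      · rintro ⟨h, w⟩ hp
        simp only [mem_sigma, mem_filter, mem_Ico, mem_Icc] at hp ⊢
        omega
      · rintro ⟨h, w⟩ hp
        simp only [mem_sigma, mem_filter, mem_Ico, mem_Icc] at hp ⊢
        omega
      · rintro ⟨h, w⟩ _
        simp
      · rintro ⟨h, w⟩ _
        simp
      · rintro ⟨h, w⟩ hp
        simp only [mem_sigma, mem_filter, mem_Ico] at hp
        change _ = 8 * formulaFour γ m P.overlap k (h + 1) (w + 1)
        rw [eight_mul_formulaFour P (by omega) (by omega) (by omega), add_sub_cancel_right,
          add_sub_cancel_right]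

end ClosedFormulas

end SCCode

theorem mainTheorem1 (γ κ m L : ℕ) (hγ : 3 ≤ γ) (hL : 2 * m + 1 ≤ L)
    (P : SCCode.Partitioning γ κ m) :
    (P.numP9 L : ℤ) =
        ∑ k ∈ Finset.Icc 1 (2 * m + 1), ((L : ℤ) - k + 1) * (P.numP9Span L k : ℤ) ∧
      ∀ k ∈ Finset.Icc 1 (2 * m + 1),
        (P.numP9Span L k : ℚ) = SCCode.formula γ m P.overlap k := by
  refine ⟨SCCode.numP9_eq_sum P hL, fun k hk => ?_⟩
  rw [Finset.mem_Icc] at hk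
  exact SCCode.numP9Span_eq_formula P hk.1 (hk.2.trans hL)
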